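/- **Theorem (Berman–Konsowa principle: flow version).** *Setting.* Let $\Omega$ be a Polish space with its Borel $\sigma$-algebra, let $k(x,dy)$ be a measurable kernel on $\Omega$ with $k(x,\Omega)<\infty$ for all $x$, and let $X=(X_t)_{t\ge 0}$ be the (minimal) Markov jump process with transition rates $k$; $\mathbb P_x$ is its law when $X_0=x$, and $\tau_C=\inf\{t>0: X_t\in C\}$. Let $\mu$ be a $\sigma$-finite measure with $k(x,\Omega)>0$ for $\mu$-a.e. $x$ that is reversible, i.e. $K(dx,dy):=\mu(dx)k(x,dy)$ is symmetric, and assume $K(\Omega\times\Omega)<\infty$. Let $X$ be irreducible: if $C$ is measurable and $\mu(C)>0$, then $\mathbb P_x(\tau_C<\infty)>0$ for $\mu$-a.e. $x$. ($X$ is then automatically recurrent: for such $C$ and $\mu$-a.e. $x$, it visits $C$ at arbitrarily large times $\mathbb P_x$-a.s.) Let $A,B\subset\Omega$ be disjoint and measurable. Let $h_{AB}=1$ on $A$, $h_{AB}=0$ on $B$, $h_{AB}(x)=\mathbb P_x(\tau_A<\tau_B)$ for $x\notin A\cup B$, and $$\mathrm{Cap}(A,B)=\int_A(-Lh_{AB})\,d\mu,\qquad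 (Lf)(x)=\int_\Omega [f(y)-f(x)]\,k(x,dy).$$ A *unit flow* from $A$ to $B$ is a $\sigma$-finite measure $\Phi$ on $\Omega\times\Omega$ such that (1) $\Phi(A\times\Omega)=1$ and $\Phi(\Omega\times A)=0$; (2) $\Phi(\Omega\times B)=1$ and $\Phi(B\times\Omega)=0$; (3) $\Phi(\Omega\times C)=\Phi(C\times\Omega)$ for all measurable $C\subset\Omega\setminus(A\cup B)$; (4) there is a measurable $\chi\subset\Omega\times\Omega$ with $\Phi(\chi^c)=0$ and $(y,x)\notin\chi$ for all $(x,y)\in\chi$. It is *loop-free* if $\chi$ in (4) can be chosen such that for every finite sequence $(\gamma_0,\dots,\gamma_n)$, $n\ge1$, with $\gamma_n=\gamma_0$, some $(\gamma_{j-1},\gamma_j)\notin\chi$. Let $\mathcal U^K_{AB}$ be the set of finite unit flows from $A$ to $B$ that are absolutely continuous with respect to $K$. For $\Phi\in\mathcal U^K_{AB}$ let $\nu(C)=\Phi(C\times\Omega)$, let $\ell$ be any probability transition kernel with $\Phi(dx,dy)=\nu(dx)\ell(x,dy)$, let $Y=(Y_n)_{n\ge0}$ be the Markov chain with initial law $\nu(A\cap\cdot)$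 and transition kernel $\ell$ (with expectation $\mathbb E^\Phi$), and let $\tau^Y_B=\min\{n\ge1: Y_n\in B\}$. *Claim.* Whatever the choice of the kernels $\ell$, $\mathrm{Cap}(A,B)\ge 0$ and $$\mathrm{Cap}(A,B)=\sup_{\Phi\in\mathcal U^K_{AB}}\mathbb E^\Phi\Bigl[\Bigl(\sum_{n=1}^{\tau^Y_B}\frac{d\Phi}{dK}(Y_{n-1},Y_n)\Bigr)^{-1}\Bigr],$$ where the supremum of the empty set is $0$. The identity remains true when the supremum is restricted to the loop-free flows in $\mathcal U^K_{AB}$. If $\mu(A)>0$ and $\mu(B)>0$, then the harmonic flow $$\Phi_{AB}(dx,dy)=\frac{1}{\mathrm{Cap}(A,B)}\,[h_{AB}(x)-h_{AB}(y)]_+\,K(dx,dy)$$ belongs to $\mathcal U^K_{AB}$, is loop-free, and attains both suprema. -/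

import Mathlib

open MeasureTheory ProbabilityTheory
open scoped ENNReal NNReal

noncomputable section

namespace BermanKonsowa

variable {Ω : Type*} [MeasurableSpace Ω]

/-! ### Discrete-time Markov chains -/

/-- The one-step kernels of a time-homogeneous chain, as functions of the whole past. -/
def stepKernel (κ : Kernel Ω Ω) (n : ℕ) :
    Kernel ((i : Finset.Iic n) → (fun _ : ℕ => Ω) i) Ω :=
  κ.comap (fun past => past ⟨n, Finset.mem_Iic.2 le_rfl⟩) (measurable_pi_apply _)

instance (κ : Kernel Ω Ω) [IsMarkovKernel κ] (n : ℕ) : IsMarkovKernel (stepKernel κ n) := by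
  unfold stepKernel; infer_instance

/-- `chainLaw κ x` is the law, on the space `ℕ → Ω` of trajectories, of the Markov chain with
transition kernel `κ` started at `x`. -/
def chainLaw (κ : Kernel Ω Ω) [IsMarkovKernel κ] : Kernel Ω (ℕ → Ω) :=
  (Kernel.traj (X := fun _ => Ω) (stepKernel κ) 0).comap (fun x _ => x)
    (measurable_pi_lambda _ fun _ => measurable_id)

/-! ### The Markov jump process with transition rates `k` -/

/-- The transition kernel of the jump chain: `k (x, dy) / k (x, Ω)` when `0 < k (x, Ω) < ∞`, and
`δ_x` when `k (x, Ω) = 0`.  (The case `k (x, Ω) = ∞` does not occur for jump processes, and gets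
a default value.) -/
def jumpKernel (k : Kernel Ω Ω) : Kernel Ω Ω := by
  classical
  exact
  { toFun := fun x =>
      if k x Set.univ = 0 ∨ k x Set.univ = ∞ then Measure.dirac x
      else (k x Set.univ)⁻¹ • k x
    measurable' := by
      have hm : Measurable fun x => k x Set.univ := Kernel.measurable_coe k MeasurableSet.univ
      refine Measurable.ite ((hm (measurableSet_singleton 0)).union
        (hm (measurableSet_singleton ∞))) Measure.measurable_dirac ?_
      refine Measure.measurable_of_measurable_coe _ fun s hs => ?_
      simp only [Measure.smul_apply, smul_eq_mul]
      exact hm.inv.mul (Kernel.measurable_coe k hs) }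

instance (k : Kernel Ω Ω) : IsMarkovKernel (jumpKernel k) where
  isProbabilityMeasure x := by
    classical
    change IsProbabilityMeasure
      (if k x Set.univ = 0 ∨ k x Set.univ = ∞ then Measure.dirac x
        else (k x Set.univ)⁻¹ • k x)
    split_ifs with h
    · infer_instance
    · rw [not_or] at h
      exact ⟨by simpa using ENNReal.inv_mul_cancel h.1 h.2⟩

instance : IsProbabilityMeasure (expMeasure 1) := isProbabilityMeasure_expMeasure one_pos

/-- The probability space of the jump process: its elements are pairs `(z, e)`, where `z` is the
trajectory of the jump chain, and `e` is a sequence of normalized waiting times. -/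
abbrev JumpPath (Ω : Type*) := (ℕ → Ω) × (ℕ → ℝ)

/-- The law `ℙ_x`: the jump chain starts at `x`, and the normalized waiting times are independent
of it and independent standard exponential variables. -/
def jumpLaw (k : Kernel Ω Ω) (x : Ω) : Measure (JumpPath Ω) :=
  (chainLaw (jumpKernel k) x).prod (Measure.infinitePi fun _ : ℕ => expMeasure 1)

/-- The time of the `n`-th jump. The waiting time in the state `z i` is `e i / k (z i, Ω)`, that is,
exponential with parameter `k (z i, Ω)` (infinite if `k (z i, Ω) = 0`). -/
def jumpTime (k : Kernel Ω Ω) (ω : JumpPath Ω) (n : ℕ) : ℝ≥0∞ :=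
  ∑ i ∈ Finset.range n, ENNReal.ofReal (ω.2 i) / k (ω.1 i) Set.univ

open Classical in
/-- The (minimal) Markov jump process `X_t` with rates `k`: `X_t = Z_n` when the `n`-th jump time is
`≤ t` and the next one is `> t`; `none` is the cemetery, where `X` is after an explosion. -/
def jumpProcess (k : Kernel Ω Ω) (ω : JumpPath Ω) (t : ℝ≥0) : Option Ω :=
  if h : ∃ n : ℕ, (t : ℝ≥0∞) < jumpTime k ω (n + 1) then some (ω.1 (Nat.find h)) else none

/-- The hitting time `τ_C = inf {t > 0 | X_t ∈ C}`, which is `∞` if there is no such `t`. -/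
def hitTime (k : Kernel Ω Ω) (C : Set Ω) (ω : JumpPath Ω) : ℝ≥0∞ :=
  ⨅ (t : ℝ≥0) (_ : 0 < t) (_ : ∃ x ∈ C, jumpProcess k ω t = some x), (t : ℝ≥0∞)

/-- The jump process is irreducible with respect to `μ`: every measurable set of positive
`μ`-measure is hit with positive probability from `μ`-almost every starting point. -/
def IsIrreducible (k : Kernel Ω Ω) (μ : Measure Ω) : Prop :=
  ∀ C : Set Ω, MeasurableSet C → 0 < μ C →
    ∀ᵐ x ∂μ, 0 < jumpLaw k x {ω | hitTime k C ω < ∞}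

/-! ### Conductance, harmonic function, capacity -/

/-- The conductance measure `K (dx, dy) = μ (dx) k (x, dy)`. -/
def conductance (k : Kernel Ω Ω) (μ : Measure Ω) : Measure (Ω × Ω) := μ.compProd k

/-- Reversibility: `μ (dx) k (x, dy) = μ (dy) k (y, dx)`. -/
def IsReversible (k : Kernel Ω Ω) (μ : Measure Ω) : Prop :=
  (conductance k μ).map Prod.swap = conductance k μ

/-- `(L f) (x) = ∫ (f y - f x) k (x, dy)`. -/
def generator (k : Kernel Ω Ω) (f : Ω → ℝ) (x : Ω) : ℝ := ∫ y, (f y - f x) ∂(k x)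

open Classical in
/-- The harmonic function `h_AB`: `1` on `A`, `0` on `B`, and `ℙ_x (τ_A < τ_B)` elsewhere. -/
def harmonicFunction (k : Kernel Ω Ω) (A B : Set Ω) (x : Ω) : ℝ :=
  if x ∈ A then 1
  else if x ∈ B then 0
  else (jumpLaw k x).real {ω | hitTime k A ω < hitTime k B ω}

/-- `Cap (A, B) = ∫_A (- L h_AB) dμ`. -/
def capacity (k : Kernel Ω Ω) (μ : Measure Ω) (A B : Set Ω) : ℝ :=
  ∫ x in A, -generator k (harmonicFunction k A B) x ∂μ

/-! ### Flows -/

/-- Unit flows from `A` to `B`. -/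
structure IsUnitFlow (A B : Set Ω) (Φ : Measure (Ω × Ω)) : Prop where
  sigmaFinite : SigmaFinite Φ
  out_of_A : Φ (A ×ˢ Set.univ) = 1
  into_A : Φ (Set.univ ×ˢ A) = 0
  into_B : Φ (Set.univ ×ˢ B) = 1
  out_of_B : Φ (B ×ˢ Set.univ) = 0
  kirchhoff : ∀ C : Set Ω, MeasurableSet C → C ⊆ (A ∪ B)ᶜ →
    Φ (Set.univ ×ˢ C) = Φ (C ×ˢ Set.univ)
  oriented : ∃ χ : Set (Ω × Ω), MeasurableSet χ ∧ Φ χᶜ = 0 ∧ ∀ x y, (x, y) ∈ χ → (y, x) ∉ χ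

/-- Loop-freeness: the set `χ` in the orientation condition can be chosen without loops. -/
def IsLoopFree (Φ : Measure (Ω × Ω)) : Prop :=
  ∃ χ : Set (Ω × Ω), MeasurableSet χ ∧ Φ χᶜ = 0 ∧ (∀ x y, (x, y) ∈ χ → (y, x) ∉ χ) ∧
    ∀ (n : ℕ) (γ : ℕ → Ω), 1 ≤ n → γ n = γ 0 → ∃ j < n, (γ j, γ (j + 1)) ∉ χ

/-- The finite unit flows from `A` to `B` that are absolutely continuous with respect to `K`. -/
def unitFlows (A B : Set Ω) (K : Measure (Ω × Ω)) : Set (Measure (Ω × Ω)) :=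
  {Φ | IsUnitFlow A B Φ ∧ Φ ≪ K ∧ IsFiniteMeasure Φ}

/-- The loop-free flows among them. -/
def loopFreeUnitFlows (A B : Set Ω) (K : Measure (Ω × Ω)) : Set (Measure (Ω × Ω)) :=
  {Φ | Φ ∈ unitFlows A B K ∧ IsLoopFree Φ}

/-- The harmonic flow `[h_AB x - h_AB y]_+ K (dx, dy) / Cap (A, B)`. -/
def harmonicFlow (k : Kernel Ω Ω) (μ : Measure Ω) (A B : Set Ω) : Measure (Ω × Ω) :=
  (conductance k μ).withDensity fun p =>
    ENNReal.ofReal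
      (max (harmonicFunction k A B p.1 - harmonicFunction k A B p.2) 0 / capacity k μ A B)

/-! ### The Markov chain of a flow -/

/-- The law of the chain `Y` with initial law `ν (A ∩ ·)`, where `ν` is the left marginal of `Φ`, and
transition kernel `κ`. -/
def flowChainLaw (A : Set Ω) (Φ : Measure (Ω × Ω)) (κ : Kernel Ω Ω) [IsMarkovKernel κ] :
    Measure (ℕ → Ω) :=
  (Φ.fst.restrict A).bind (chainLaw κ)

/-- `τ_B = min {n ≥ 1 | Y_n ∈ B}`, which is `∞` if there is no such `n`. -/
def chainHitTime (B : Set Ω) (Y : ℕ → Ω) : ℕ∞ :=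
  ⨅ (n : ℕ) (_ : 1 ≤ n ∧ Y n ∈ B), (n : ℕ∞)

open Classical in
/-- `∑_{n = 1}^{τ_B} (dΦ/dK) (Y_{n-1}, Y_n)`. -/
def pathResistance (B : Set Ω) (K Φ : Measure (Ω × Ω)) (Y : ℕ → Ω) : ℝ≥0∞ :=
  ∑' n : ℕ, if ((n + 1 : ℕ) : ℕ∞) ≤ chainHitTime B Y then Φ.rnDeriv K (Y n, Y (n + 1)) else 0

/-- `E^Φ [(∑_{n = 1}^{τ_B} (dΦ/dK) (Y_{n-1}, Y_n))⁻¹]`, for the chain `Y` with kernel `κ`. -/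
def flowExpectation (A B : Set Ω) (K Φ : Measure (Ω × Ω)) (κ : Kernel Ω Ω) [IsMarkovKernel κ] :
    ℝ≥0∞ :=
  ∫⁻ Y, (pathResistance B K Φ Y)⁻¹ ∂(flowChainLaw A Φ κ)

end BermanKonsowa

end

/-! Let `g` be the potential, `c` its flux out of `A`, `φ = dΦ/dK`, and `Δg` the drop of `g` along
an edge.

Upper bound: along a path of the flow chain from `A` to `B` the drops add up to `1`, so
Cauchy–Schwarz gives `(∑ φ)⁻¹ ≤ ∑ (Δg)² / φ` (`inv_sum_le_sum_div`). Kirchhoff's law makes the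
marginal of `Φ` a supersolution for the chain killed on `B`, so the expected edge crossings before
that time are dominated by `Φ` (`tsum_setLIntegral_stayBefore_le`). The expectation is therefore at
most `∫ (Δg)² / φ dΦ ≤ ∫_χ (Δg)² dK`. By orientation `χ` contains at most one direction of each
edge, so this is at most half of `∫ (Δg)² dK = 2c`.

Equality: on the edges used by the harmonic flow `φ = Δg / c`, so the path sum telescopes to the
constant `1 / c`.

It remains to see that `h_AB` is such a potential. For almost every start, which set is hit first
depends on the jump chain alone, and this chain is reversible with a finite stationary measure.
First-step analysis gives harmonicity, and summation by parts the energy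
(`isEquilibrium_of_harmonic`). Irreducibility serves only to make the capacity positive
(`capacity_pos`); if `A` or `B` is null the capacity vanishes and the lower bound is trivial. -/

namespace BermanKonsowa

set_option linter.unusedSectionVars false

/-! ### Markov chains killed outside a set: Markov property and occupation measures -/

section Chain

variable {Ω : Type*} [MeasurableSpace Ω]

/-- The trajectories that stay in `S` before time `n`. -/
def stayBefore (S : Set Ω) (n : ℕ) : Set (ℕ → Ω) := {Y | ∀ m < n, Y m ∈ S}

lemma measurableSet_stayBefore {S : Set Ω} (hS : MeasurableSet S) (n : ℕ) :
    MeasurableSet (stayBefore S n) := by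
  have : stayBefore S n = ⋂ m, ⋂ (_ : m < n), (fun Y : ℕ → Ω => Y m) ⁻¹' S := by
    ext Y; simp [stayBefore]
  rw [this]
  exact MeasurableSet.iInter fun m => MeasurableSet.iInter fun _ => measurable_pi_apply m hS

lemma stayBefore_succ (S : Set Ω) (n : ℕ) :
    stayBefore S (n + 1) = stayBefore S n ∩ (fun Y : ℕ → Ω => Y n) ⁻¹' S := by
  refine Set.Subset.antisymm (fun Y h => ⟨fun m hm => h m (by omega), h n (by omega)⟩) ?_
  · rintro Y ⟨h, hn⟩ m hm
    rcases Nat.lt_succ_iff_lt_or_eq.1 hm with h' | rfl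
    exacts [h m h', hn]

variable (κ : Kernel Ω Ω) [IsMarkovKernel κ]

instance : IsMarkovKernel (chainLaw κ) := by unfold chainLaw; infer_instance

lemma lintegral_chainLaw_zero (x : Ω) {f : Ω → ℝ≥0∞} (hf : Measurable f) :
    ∫⁻ Y, f (Y 0) ∂(chainLaw κ x) = f x := by
  have h := Kernel.traj_map_frestrictLe_apply (X := fun _ => Ω) (κ := stepKernel κ) 0 0
    (fun _ => x)
  have h2 : ∫⁻ Y, f (Y 0) ∂(chainLaw κ x) =
      ∫⁻ u, f (u ⟨0, by simp⟩) ∂((chainLaw κ x).map (Preorder.frestrictLe 0)) := by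
    rw [lintegral_map (by fun_prop) (by fun_prop)]
    rfl
  rw [h2, chainLaw, Kernel.comap_apply, h, Kernel.partialTraj_self, Kernel.id_apply,
    lintegral_dirac' _ (by fun_prop)]

lemma ae_chainLaw_zero_mem {x : Ω} {S : Set Ω} (hS : MeasurableSet S) (hx : x ∈ S) :
    ∀ᵐ Y ∂(chainLaw κ x), Y 0 ∈ S := by
  have hf : Measurable (Sᶜ.indicator (1 : Ω → ℝ≥0∞)) := measurable_one.indicator hS.compl
  have h := lintegral_chainLaw_zero κ x hf
  rw [Set.indicator_of_notMem (by simpa using hx), lintegral_eq_zero_iff (by fun_prop)] at h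
  filter_upwards [h] with Y hY
  by_contra hc
  simp [hc] at hY

/-- The Markov property at time `n`, on the event that the chain stays in `S` up to time `n`. -/
lemma setLIntegral_chainLaw_succ (x : Ω) {S : Set Ω} (hS : MeasurableSet S) (n : ℕ)
    {w : Ω × Ω → ℝ≥0∞} (hw : Measurable w) :
    ∫⁻ Y in stayBefore S (n + 1), w (Y n, Y (n + 1)) ∂(chainLaw κ x) =
      ∫⁻ Y in stayBefore S (n + 1), ∫⁻ y, w (Y n, y) ∂κ (Y n) ∂(chainLaw κ x) := by
  -- The event depends only on the coordinates up to `n`, so it is the preimage of a set `S'` of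
  -- pasts. The joint law of the past and the next state is a composition product, and `S'` factors
  -- out.
  let S' : Set ((i : Finset.Iic n) → (fun _ : ℕ => Ω) i) := {u | ∀ i, u i ∈ S}
  have hS' : MeasurableSet S' := by
    have : S' = ⋂ i, (fun u : (i : Finset.Iic n) → (fun _ : ℕ => Ω) i => u i) ⁻¹' S := by
      ext; simp [S']
    rw [this]
    exact MeasurableSet.iInter fun i => measurable_pi_apply i hS
  have hpre : stayBefore S (n + 1) = Preorder.frestrictLe (π := fun _ => Ω) n ⁻¹' S' := by
    ext Y
    simp [stayBefore, S']
  have hst := measurableSet_stayBefore hS (n + 1)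
  let N : Finset.Iic n := ⟨n, Finset.mem_Iic.2 le_rfl⟩
  have hW : Measurable fun a : Ω => ∫⁻ y, w (a, y) ∂κ a := hw.lintegral_kernel_prod_right'
  have key := Kernel.partialTraj_compProd_eq_map_traj (X := fun _ => Ω) (κ := stepKernel κ)
    (Nat.zero_le n) (x₀ := fun _ => x)
  have e1 : ∫⁻ Y in stayBefore S (n + 1), w (Y n, Y (n + 1)) ∂(chainLaw κ x) =
      ∫⁻ p, S'.indicator (fun u => w (u N, p.2)) p.1
        ∂((chainLaw κ x).map (fun Y => (Preorder.frestrictLe n Y, Y (n + 1)))) := by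
    rw [lintegral_map _ (by fun_prop), ← lintegral_indicator hst]
    · refine lintegral_congr fun Y => ?_
      rw [hpre]; rfl
    · have : (fun p : ((i : Finset.Iic n) → (fun _ : ℕ => Ω) i) × Ω =>
          S'.indicator (fun u => w (u N, p.2)) p.1) =
          (Prod.fst ⁻¹' S').indicator (fun p => w (p.1 N, p.2)) := rfl
      rw [this]
      exact Measurable.indicator (by fun_prop) (measurable_fst hS')
  have e2 : ∫⁻ Y in stayBefore S (n + 1), ∫⁻ y, w (Y n, y) ∂κ (Y n) ∂(chainLaw κ x) =
      ∫⁻ u, S'.indicator (fun u => ∫⁻ y, w (u N, y) ∂κ (u N)) u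
        ∂((chainLaw κ x).map (Preorder.frestrictLe n)) := by
    rw [lintegral_map _ (by fun_prop), ← lintegral_indicator hst]
    · refine lintegral_congr fun Y => ?_
      rw [hpre]; rfl
    · exact Measurable.indicator (hW.comp (measurable_pi_apply N)) hS'
  rw [e1, e2, chainLaw, Kernel.comap_apply]
  erw [← key, Kernel.traj_map_frestrictLe_apply]
  rw [Measure.lintegral_compProd]
  · refine lintegral_congr fun u => ?_
    by_cases hu : u ∈ S'
    · simp only [Set.indicator_of_mem hu, stepKernel, Kernel.comap_apply]; rfl
    · simp [Set.indicator_of_notMem hu]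
  · have : (fun p : ((i : Finset.Iic n) → (fun _ : ℕ => Ω) i) × Ω =>
        S'.indicator (fun u => w (u N, p.2)) p.1) =
        (Prod.fst ⁻¹' S').indicator (fun p => w (p.1 N, p.2)) := rfl
    rw [this]
    exact Measurable.indicator (by fun_prop) (measurable_fst hS')

lemma measurable_chainLaw : Measurable (fun x => chainLaw κ x) := (chainLaw κ).measurable

lemma ae_bind_chainLaw_zero_mem {m : Measure Ω} {S : Set Ω} (hS : MeasurableSet S)
    (hm : ∀ᵐ x ∂m, x ∈ S) : ∀ᵐ Y ∂(m.bind (chainLaw κ)), Y 0 ∈ S :=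
  Measure.ae_comp_of_ae_ae (measurable_pi_apply 0 hS)
    (hm.mono fun _ hx => ae_chainLaw_zero_mem κ hS hx)

lemma lintegral_bind_chainLaw (m : Measure Ω) {F : (ℕ → Ω) → ℝ≥0∞} (hF : Measurable F) :
    ∫⁻ Y, F Y ∂(m.bind (chainLaw κ)) = ∫⁻ x, ∫⁻ Y, F Y ∂(chainLaw κ x) ∂m :=
  Measure.lintegral_bind (measurable_chainLaw κ).aemeasurable hF.aemeasurable

lemma setLIntegral_bind_chainLaw (m : Measure Ω) {F : (ℕ → Ω) → ℝ≥0∞} (hF : Measurable F)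
    {s : Set (ℕ → Ω)} (hs : MeasurableSet s) :
    ∫⁻ Y in s, F Y ∂(m.bind (chainLaw κ)) = ∫⁻ x, ∫⁻ Y in s, F Y ∂(chainLaw κ x) ∂m := by
  simp_rw [← lintegral_indicator hs]
  exact lintegral_bind_chainLaw κ m (hF.indicator hs)

lemma setLIntegral_bind_chainLaw_succ (m : Measure Ω) {S : Set Ω} (hS : MeasurableSet S) (n : ℕ)
    {w : Ω × Ω → ℝ≥0∞} (hw : Measurable w) :
    ∫⁻ Y in stayBefore S (n + 1), w (Y n, Y (n + 1)) ∂(m.bind (chainLaw κ)) =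
      ∫⁻ Y in stayBefore S (n + 1), ∫⁻ y, w (Y n, y) ∂κ (Y n) ∂(m.bind (chainLaw κ)) := by
  have hW : Measurable fun a : Ω => ∫⁻ y, w (a, y) ∂κ a := hw.lintegral_kernel_prod_right'
  have hst := measurableSet_stayBefore hS (n + 1)
  rw [setLIntegral_bind_chainLaw κ m (by fun_prop) hst,
    setLIntegral_bind_chainLaw κ m (F := fun Y => ∫⁻ y, w (Y n, y) ∂κ (Y n))
      (hW.comp (measurable_pi_apply n)) hst]
  exact lintegral_congr fun x => setLIntegral_chainLaw_succ κ x hS n hw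

/-- The transition operator of the chain killed outside `S`. -/
noncomputable def killedOperator (S : Set Ω) (f : Ω → ℝ≥0∞) (x : Ω) : ℝ≥0∞ :=
  S.indicator (fun x => ∫⁻ y, f y ∂κ x) x

lemma measurable_killedOperator {S : Set Ω} (hS : MeasurableSet S) {f : Ω → ℝ≥0∞}
    (hf : Measurable f) : Measurable (killedOperator κ S f) :=
  hf.lintegral_kernel.indicator hS

lemma measurable_killedOperator_iterate {S : Set Ω} (hS : MeasurableSet S) (n : ℕ)
    {f : Ω → ℝ≥0∞} (hf : Measurable f) : Measurable ((killedOperator κ S)^[n] f) := by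
  induction n with
  | zero => exact hf
  | succ n ih =>
    rw [Function.iterate_succ_apply']
    exact measurable_killedOperator κ hS ih

lemma setLIntegral_chainLaw_eq_iterate (x : Ω) {S : Set Ω} (hS : MeasurableSet S) (n : ℕ)
    {f : Ω → ℝ≥0∞} (hf : Measurable f) :
    ∫⁻ Y in stayBefore S n, f (Y n) ∂(chainLaw κ x) = (killedOperator κ S)^[n] f x := by
  induction n generalizing f with
  | zero =>
    have : stayBefore S 0 = Set.univ := by ext; simp [stayBefore]
    rw [this, Measure.restrict_univ, lintegral_chainLaw_zero κ x hf]
    rfl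
  | succ n ih =>
    have h := setLIntegral_chainLaw_succ κ x hS n (w := fun p => f p.2) (by fun_prop)
    rw [Function.iterate_succ_apply, ← ih (measurable_killedOperator κ hS hf)]
    refine h.trans ?_
    rw [stayBefore_succ, Set.inter_comm,
      ← setLIntegral_indicator (measurable_pi_apply n hS)]
    rfl

lemma setLIntegral_stayBefore_one (m : Measure Ω) {S : Set Ω} (hS : MeasurableSet S)
    {f : Ω → ℝ≥0∞} (hf : Measurable f) :
    ∫⁻ Y in stayBefore S 1, f (Y 0) ∂(m.bind (chainLaw κ)) = ∫⁻ x in S, f x ∂m := by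
  rw [setLIntegral_bind_chainLaw κ m (by fun_prop) (measurableSet_stayBefore hS 1),
    ← lintegral_indicator hS]
  refine lintegral_congr fun x => ?_
  rw [← lintegral_chainLaw_zero κ x (hf.indicator hS),
    ← lintegral_indicator (measurableSet_stayBefore hS 1)]
  refine lintegral_congr fun Y => ?_
  have : stayBefore S 1 = (fun Y : ℕ → Ω => Y 0) ⁻¹' S := by
    ext Y; simp [stayBefore]
  rw [this]; rfl

/-- The constraint at the last time is absorbed into the integrand, and the Markov property removes
the last step. This recursion drives the inductions for null sets and occupation measures below. -/
lemma setLIntegral_stayBefore_add_two (m : Measure Ω) {S : Set Ω} (hS : MeasurableSet S) (n : ℕ)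
    {f : Ω → ℝ≥0∞} (hf : Measurable f) :
    ∫⁻ Y in stayBefore S (n + 2), f (Y (n + 1)) ∂(m.bind (chainLaw κ)) =
      ∫⁻ Y in stayBefore S (n + 1), ∫⁻ y, S.indicator f y ∂κ (Y n) ∂(m.bind (chainLaw κ)) := by
  have hf' := hf.indicator hS
  rw [← setLIntegral_bind_chainLaw_succ κ m hS n (w := fun p => S.indicator f p.2) (by fun_prop),
    stayBefore_succ S (n + 1), Set.inter_comm,
    ← setLIntegral_indicator (measurable_pi_apply (n + 1) hS)]
  rfl

/-- If `ν` dominates the law of the chain under the killed dynamics, then a property which holds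
almost everywhere for `ν ⊗ κ` holds along the trajectory, as long as it stays in `S`. -/
lemma ae_forall_stayBefore_of_ae {m ν : Measure Ω} [SFinite ν] {S : Set Ω} (hS : MeasurableSet S)
    (hm : m.restrict S ≪ ν) (hν : (ν.bind κ).restrict S ≪ ν) {Q : Ω × Ω → Prop}
    (hQ : ∀ᵐ p ∂(ν.compProd κ), Q p) :
    ∀ᵐ Y ∂(m.bind (chainLaw κ)), ∀ n, Y ∈ stayBefore S (n + 1) → Q (Y n, Y (n + 1)) := by
  -- The law of `Y n` on the event of no exit from `S` is absolutely continuous with respect to `ν`;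
  -- stated with test functions so that the induction can replace `f` by its image under the killed
  -- operator.
  have hnull : ∀ n, ∀ f : Ω → ℝ≥0∞, Measurable f → f =ᵐ[ν] 0 →
      ∫⁻ Y in stayBefore S (n + 1), f (Y n) ∂(m.bind (chainLaw κ)) = 0 := by
    intro n
    induction n with
    | zero =>
      intro f hf h0
      rw [setLIntegral_stayBefore_one κ m hS hf, lintegral_eq_zero_iff hf]
      exact hm.ae_le h0
    | succ n ih =>
      intro f hf h0
      rw [setLIntegral_stayBefore_add_two κ m hS n hf]
      have hf' := hf.indicator hS
      refine ih (fun x => ∫⁻ y, S.indicator f y ∂κ x) hf'.lintegral_kernel ?_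
      rw [← lintegral_eq_zero_iff hf'.lintegral_kernel,
        ← Measure.lintegral_bind κ.measurable.aemeasurable hf'.aemeasurable,
        lintegral_indicator hS, lintegral_eq_zero_iff hf]
      exact hν.ae_le h0
  obtain ⟨T, hT, hTm, hT0⟩ := exists_measurable_superset_of_null (ae_iff.1 hQ)
  have hw : Measurable (T.indicator (1 : Ω × Ω → ℝ≥0∞)) := measurable_one.indicator hTm
  rw [ae_all_iff]
  intro n
  have hst := measurableSet_stayBefore hS (n + 1)
  rw [← ae_restrict_iff'₀ hst.nullMeasurableSet]
  have h0 : ∫⁻ Y in stayBefore S (n + 1), T.indicator 1 (Y n, Y (n + 1))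
      ∂(m.bind (chainLaw κ)) = 0 := by
    rw [setLIntegral_bind_chainLaw_succ κ m hS n hw]
    refine hnull n (fun x => ∫⁻ y, T.indicator 1 (x, y) ∂κ x) hw.lintegral_kernel_prod_right' ?_
    rw [← lintegral_eq_zero_iff hw.lintegral_kernel_prod_right', ← Measure.lintegral_compProd hw,
      lintegral_indicator_one hTm, hT0]
  rw [lintegral_eq_zero_iff (by fun_prop)] at h0
  filter_upwards [h0] with Y hY
  by_contra hc
  have : (Y n, Y (n + 1)) ∈ T := hT hc
  simp [this] at hY

/-- Comparison of the occupation measure of the killed chain with a supersolution `ν`. -/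
lemma sum_setLIntegral_stayBefore_le {m ν : Measure Ω} {S : Set Ω} (hS : MeasurableSet S)
    (hν : (m + ν.bind κ).restrict S ≤ ν) (N : ℕ) {f : Ω → ℝ≥0∞} (hf : Measurable f) :
    ∑ n ∈ Finset.range N, ∫⁻ Y in stayBefore S (n + 1), f (Y n) ∂(m.bind (chainLaw κ)) ≤
      ∫⁻ x, f x ∂ν := by
  induction N generalizing f with
  | zero => simp
  | succ N ih =>
    have hf' := hf.indicator hS
    -- Time `0` contributes `m`; the later times form the sum of length `N` for the transported
    -- function, which turns `ν` into `ν.bind κ`.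
    rw [Finset.sum_range_succ', setLIntegral_stayBefore_one κ m hS hf]
    simp_rw [setLIntegral_stayBefore_add_two κ m hS _ hf]
    calc _ ≤ ∫⁻ x, ∫⁻ y, S.indicator f y ∂κ x ∂ν + ∫⁻ x in S, f x ∂m := by
          gcongr
          exact ih hf'.lintegral_kernel
      _ = ∫⁻ x, f x ∂((m + ν.bind κ).restrict S) := by
          rw [← Measure.lintegral_bind κ.measurable.aemeasurable hf'.aemeasurable,
            lintegral_indicator hS, Measure.restrict_add, lintegral_add_measure, add_comm]
      _ ≤ _ := lintegral_mono' hν le_rfl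

/-- From visits of states to crossings of edges: given `Y n`, the next state has law `κ (Y n)`, so
`w` may be replaced by its average over the endpoint. -/
lemma tsum_setLIntegral_stayBefore_le {m ν : Measure Ω} [SFinite ν] {S : Set Ω}
    (hS : MeasurableSet S) (hν : (m + ν.bind κ).restrict S ≤ ν) {w : Ω × Ω → ℝ≥0∞}
    (hw : Measurable w) :
    ∑' n, ∫⁻ Y in stayBefore S (n + 1), w (Y n, Y (n + 1)) ∂(m.bind (chainLaw κ)) ≤
      ∫⁻ p, w p ∂(ν.compProd κ) := by
  rw [Measure.lintegral_compProd hw]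
  simp_rw [setLIntegral_bind_chainLaw_succ κ m hS _ hw]
  refine ENNReal.summable.tsum_le_of_sum_range_le fun N => ?_
  exact sum_setLIntegral_stayBefore_le κ hS hν N hw.lintegral_kernel_prod_right'

end Chain

/-! ### Reduction of the jump process to its jump chain; hitting probabilities -/

section Jump

variable {Ω : Type*} [MeasurableSpace Ω] (k : Kernel Ω Ω)

/-- The jump paths with positive waiting times and without absorbing states. -/
def regularPaths : Set (JumpPath Ω) := {ω | ∀ i, 0 < ω.2 i ∧ k (ω.1 i) Set.univ ≠ 0}

lemma jumpTime_zero (ω : JumpPath Ω) : jumpTime k ω 0 = 0 := by simp [jumpTime]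

lemma jumpTime_succ (ω : JumpPath Ω) (n : ℕ) :
    jumpTime k ω (n + 1) =
      jumpTime k ω n + ENNReal.ofReal (ω.2 n) / k (ω.1 n) Set.univ := by
  simp [jumpTime, Finset.sum_range_succ]

lemma jumpTime_monotone (ω : JumpPath Ω) : Monotone (jumpTime k ω) :=
  monotone_nat_of_le_succ fun n => by rw [jumpTime_succ]; exact le_self_add

lemma jumpTime_ne_top {ω : JumpPath Ω} (hω : ω ∈ regularPaths k) (n : ℕ) :
    jumpTime k ω n ≠ ∞ := by
  induction n with
  | zero => simp [jumpTime_zero]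
  | succ n ih =>
    rw [jumpTime_succ]
    exact ENNReal.add_ne_top.2 ⟨ih, ENNReal.div_ne_top ENNReal.ofReal_ne_top (hω n).2⟩

lemma jumpTime_lt_succ (hk : ∀ x, k x Set.univ ≠ ∞) {ω : JumpPath Ω} (hω : ω ∈ regularPaths k)
    (n : ℕ) : jumpTime k ω n < jumpTime k ω (n + 1) := by
  rw [jumpTime_succ]
  refine ENNReal.lt_add_right (jumpTime_ne_top k hω n) ?_
  exact (ENNReal.div_pos (ENNReal.ofReal_pos.2 (hω n).1).ne' (hk _)).ne'

lemma exists_of_jumpProcess_eq {ω : JumpPath Ω} {t : ℝ≥0} {x : Ω}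
    (h : jumpProcess k ω t = some x) :
    ∃ n, jumpTime k ω n ≤ t ∧ (t : ℝ≥0∞) < jumpTime k ω (n + 1) ∧ ω.1 n = x := by
  classical
  unfold jumpProcess at h
  split_ifs at h with hex
  refine ⟨Nat.find hex, ?_, Nat.find_spec hex, by simpa using h⟩
  rcases hn : Nat.find hex with _ | m
  · simp [jumpTime_zero]
  · exact not_lt.1 (Nat.find_min hex (m := m) (by omega))

lemma jumpProcess_eq {ω : JumpPath Ω} {t : ℝ≥0} {n : ℕ} (h1 : jumpTime k ω n ≤ t)
    (h2 : (t : ℝ≥0∞) < jumpTime k ω (n + 1)) : jumpProcess k ω t = some (ω.1 n) := by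
  classical
  have hex : ∃ n : ℕ, (t : ℝ≥0∞) < jumpTime k ω (n + 1) := ⟨n, h2⟩
  have hfind : Nat.find hex = n := by
    rw [Nat.find_eq_iff]
    refine ⟨h2, fun m hm => not_lt.2 ((jumpTime_monotone k ω (by omega)).trans h1)⟩
  unfold jumpProcess
  rw [dif_pos hex, hfind]

lemma exists_mem_of_hitTime_lt_top {C : Set Ω} {ω : JumpPath Ω} (h : hitTime k C ω < ∞) :
    ∃ n, ω.1 n ∈ C := by
  by_contra! hc
  refine h.ne ?_
  unfold hitTime
  refine iInf_eq_top.2 fun t => iInf_eq_top.2 fun _ => iInf_eq_top.2 ?_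
  rintro ⟨x, hx, hX⟩
  obtain ⟨n, -, -, rfl⟩ := exists_of_jumpProcess_eq k hX
  exact absurd hx (hc n)

/-- The process occupies `ω.1 n` on an interval of positive length starting at the `n`-th jump time,
hence at strictly positive times arbitrarily close to it. This covers `n = 0`, where the jump time
itself is not admissible. -/
lemma hitTime_le_jumpTime (hk : ∀ x, k x Set.univ ≠ ∞) {C : Set Ω} {ω : JumpPath Ω}
    (hω : ω ∈ regularPaths k) {n : ℕ} (hn : ω.1 n ∈ C) : hitTime k C ω ≤ jumpTime k ω n := by
  refine le_of_forall_gt_imp_ge_of_dense fun a ha => ?_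
  obtain ⟨t, ht1, ht2⟩ := ENNReal.lt_iff_exists_nnreal_btwn.1
    (lt_min ha (jumpTime_lt_succ k hk hω n))
  have hX := jumpProcess_eq k ht1.le (ht2.trans_le (min_le_right _ _))
  have ht0 : 0 < t := by
    have : (0 : ℝ≥0∞) < t := zero_le.trans_lt ht1
    exact_mod_cast this
  exact (iInf₂_le_of_le t ht0 (iInf_le_of_le ⟨_, hn, hX⟩ le_rfl)).trans
    (ht2.le.trans (min_le_left _ _))

lemma jumpTime_le_hitTime {C : Set Ω} {ω : JumpPath Ω} {n : ℕ} (hn : ∀ m < n, ω.1 m ∉ C) :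
    jumpTime k ω n ≤ hitTime k C ω := by
  refine le_iInf fun t => le_iInf fun _ => le_iInf ?_
  rintro ⟨x, hx, hX⟩
  obtain ⟨m, hm, -, rfl⟩ := exists_of_jumpProcess_eq k hX
  have : n ≤ m := by
    by_contra! h
    exact hn m h hx
  exact (jumpTime_monotone k ω this).trans hm

/-- Jump times of a regular path are finite and strictly increasing, so the order of the hitting
times is the order of first visits by the jump chain. Explosion plays no role, since only finitely
many jumps are compared. -/
lemma hitTime_lt_hitTime_iff (hk : ∀ x, k x Set.univ ≠ ∞) {A B : Set Ω} (hAB : Disjoint A B)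
    {ω : JumpPath Ω} (hω : ω ∈ regularPaths k) :
    hitTime k A ω < hitTime k B ω ↔ ∃ n, ω.1 n ∈ A ∧ ω.1 ∈ stayBefore (A ∪ B)ᶜ n := by
  classical
  constructor
  · intro h
    have hex := exists_mem_of_hitTime_lt_top k (h.trans_le le_top)
    refine ⟨Nat.find hex, Nat.find_spec hex, fun m hm hmem => ?_⟩
    rcases hmem with hmA | hmB
    · exact Nat.find_min hex hm hmA
    · have h1 := hitTime_le_jumpTime k hk hω hmB
      have h2 : jumpTime k ω (Nat.find hex) ≤ hitTime k A ω :=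
        jumpTime_le_hitTime k fun j hj => Nat.find_min hex hj
      exact absurd h (not_lt.2 (h1.trans ((jumpTime_monotone k ω hm.le).trans h2)))
  · rintro ⟨n, hn, hst⟩
    refine (hitTime_le_jumpTime k hk hω hn).trans_lt ((jumpTime_lt_succ k hk hω n).trans_le ?_)
    refine jumpTime_le_hitTime k fun m hm hmB => ?_
    rcases Nat.lt_succ_iff_lt_or_eq.1 hm with h | rfl
    · exact hst m h (Or.inr hmB)
    · exact Set.disjoint_left.1 hAB hn hmB

/-- The trajectories which reach `A`, and stay outside `A ∪ B` before. -/
def hitsFirst (A B : Set Ω) : Set (ℕ → Ω) := {Y | ∃ n, Y n ∈ A ∧ Y ∈ stayBefore (A ∪ B)ᶜ n}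

lemma hitsFirst_eq_iUnion (A B : Set Ω) :
    hitsFirst A B = ⋃ n, (fun Y : ℕ → Ω => Y n) ⁻¹' A ∩ stayBefore (A ∪ B)ᶜ n := by
  refine Set.Subset.antisymm ?_ ?_
  · rintro Y ⟨n, h⟩
    exact Set.mem_iUnion.2 ⟨n, h⟩
  · intro Y hY
    exact Set.mem_iUnion.1 hY

lemma measurableSet_hitsFirst {A B : Set Ω} (hA : MeasurableSet A) (hB : MeasurableSet B) :
    MeasurableSet (hitsFirst A B) := by
  rw [hitsFirst_eq_iUnion]
  exact MeasurableSet.iUnion fun n =>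
    (measurable_pi_apply n hA).inter (measurableSet_stayBefore (hA.union hB).compl n)

lemma ae_waitingTimes_pos :
    ∀ᵐ e ∂(Measure.infinitePi fun _ : ℕ => expMeasure 1), ∀ i, 0 < e i := by
  rw [ae_all_iff]
  intro i
  have h := (measurePreserving_eval_infinitePi (fun _ : ℕ => expMeasure 1) i)
  refine h.quasiMeasurePreserving.ae (p := fun t => 0 < t) ?_
  rw [ae_iff]
  have : {a : ℝ | ¬ 0 < a} = Set.Iic 0 := by ext; simp
  rw [this]
  rw [← ofReal_cdf (expMeasure 1) 0, cdf_expMeasure_eq one_pos]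
  simp

lemma jumpLaw_hitTime_lt (hk : ∀ x, k x Set.univ ≠ ∞) {A B : Set Ω} (hAB : Disjoint A B)
    {x : Ω} (hx : ∀ᵐ Y ∂(chainLaw (jumpKernel k) x), ∀ i, k (Y i) Set.univ ≠ 0) :
    jumpLaw k x {ω | hitTime k A ω < hitTime k B ω} =
      chainLaw (jumpKernel k) x (hitsFirst A B) := by
  have h1 : ∀ᵐ ω ∂(jumpLaw k x), ∀ i, k (ω.1 i) Set.univ ≠ 0 :=
    Measure.quasiMeasurePreserving_fst.ae hx
  have h2 : ∀ᵐ ω ∂(jumpLaw k x), ∀ i, 0 < ω.2 i :=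
    Measure.quasiMeasurePreserving_snd.ae ae_waitingTimes_pos
  have h3 : {ω | hitTime k A ω < hitTime k B ω} =ᵐ[jumpLaw k x]
      Prod.fst ⁻¹' (hitsFirst A B) := by
    filter_upwards [h1, h2] with ω hω1 hω2
    exact propext (hitTime_lt_hitTime_iff k hk hAB fun i => ⟨hω2 i, hω1 i⟩)
  rw [measure_congr h3, ← Set.prod_univ, jumpLaw, Measure.prod_prod, measure_univ, mul_one]

/-- The only form in which irreducibility is used. -/
lemma ae_pos_chainLaw_exists_mem {μ : Measure Ω} (hirr : IsIrreducible k μ) {C : Set Ω}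
    (hC : MeasurableSet C) (hμC : 0 < μ C) :
    ∀ᵐ x ∂μ, 0 < chainLaw (jumpKernel k) x {Y | ∃ n, Y n ∈ C} := by
  filter_upwards [hirr C hC hμC] with x hx
  refine hx.trans_le ?_
  calc jumpLaw k x {ω | hitTime k C ω < ∞}
      ≤ jumpLaw k x ({Y | ∃ n, Y n ∈ C} ×ˢ Set.univ) :=
        measure_mono fun ω hω => ⟨exists_mem_of_hitTime_lt_top k hω, trivial⟩
    _ = _ := by rw [jumpLaw, Measure.prod_prod, measure_univ, mul_one]

/-- The probability that the chain reaches `A` before `B`. -/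
noncomputable def hitProb (A B : Set Ω) (x : Ω) : ℝ≥0∞ :=
  chainLaw (jumpKernel k) x (hitsFirst A B)

/-- The event is split according to the time of the first visit to `A`; the pieces are disjoint
because the path avoids `A` before. -/
lemma hitProb_eq_tsum {A B : Set Ω} (hA : MeasurableSet A) (hB : MeasurableSet B) (x : Ω) :
    hitProb k A B x =
      ∑' n, (killedOperator (jumpKernel k) (A ∪ B)ᶜ)^[n] (A.indicator 1) x := by
  have hU := (hA.union hB).compl
  have hpre : ∀ n, MeasurableSet ((fun Y : ℕ → Ω => Y n) ⁻¹' A) :=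
    fun n => measurable_pi_apply n hA
  rw [hitProb, hitsFirst_eq_iUnion, measure_iUnion]
  · refine tsum_congr fun n => ?_
    rw [← setLIntegral_chainLaw_eq_iterate _ x hU n (measurable_one.indicator hA),
      ← Measure.restrict_apply (hpre n), ← lintegral_indicator_one (hpre n)]
    rfl
  · intro i j hij
    wlog h : i < j generalizing i j
    · exact (this hij.symm (by omega)).symm
    refine Set.disjoint_left.2 fun Y hi hj => ?_
    exact hj.2 i h (Or.inl hi.1)
  · exact fun n => (hpre n).inter (measurableSet_stayBefore hU n)

lemma measurable_hitProb {A B : Set Ω} (hA : MeasurableSet A) (hB : MeasurableSet B) :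
    Measurable (hitProb k A B) :=
  Kernel.measurable_coe _ (measurableSet_hitsFirst hA hB)

lemma hitProb_le_one (A B : Set Ω) (x : Ω) : hitProb k A B x ≤ 1 := prob_le_one

/-- First-step analysis, obtained by shifting the index in the series of `hitProb_eq_tsum` rather
than the trajectories. -/
lemma hitProb_eq_add {A B : Set Ω} (hA : MeasurableSet A) (hB : MeasurableSet B) (x : Ω) :
    hitProb k A B x =
      A.indicator 1 x + killedOperator (jumpKernel k) (A ∪ B)ᶜ (hitProb k A B) x := by
  have hU := (hA.union hB).compl
  have hm : ∀ n, Measurable ((killedOperator (jumpKernel k) (A ∪ B)ᶜ)^[n] (A.indicator 1)) :=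
    fun n => measurable_killedOperator_iterate _ hU n (measurable_one.indicator hA)
  rw [hitProb_eq_tsum k hA hB, tsum_eq_zero_add' ENNReal.summable]
  congr 1
  simp_rw [Function.iterate_succ_apply']
  by_cases hx : x ∈ (A ∪ B)ᶜ
  · simp_rw [killedOperator, Set.indicator_of_mem hx]
    rw [← lintegral_tsum fun n => (hm n).aemeasurable]
    exact lintegral_congr fun y => (hitProb_eq_tsum k hA hB y).symm
  · simp_rw [killedOperator, Set.indicator_of_notMem hx, tsum_zero]

lemma hitProb_of_mem_left {A B : Set Ω} (hA : MeasurableSet A) (hB : MeasurableSet B) {x : Ω}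
    (hx : x ∈ A) : hitProb k A B x = 1 := by
  have hx' : x ∉ (A ∪ B)ᶜ := fun h => h (Or.inl hx)
  rw [hitProb_eq_add k hA hB, killedOperator, Set.indicator_of_notMem hx']
  simp [hx]

lemma hitProb_of_mem_right {A B : Set Ω} (hA : MeasurableSet A) (hB : MeasurableSet B)
    (hAB : Disjoint A B) {x : Ω} (hx : x ∈ B) : hitProb k A B x = 0 := by
  have hx' : x ∉ (A ∪ B)ᶜ := fun h => h (Or.inr hx)
  rw [hitProb_eq_add k hA hB, killedOperator,
    Set.indicator_of_notMem (Set.disjoint_right.1 hAB hx),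
    Set.indicator_of_notMem hx', add_zero]

lemma hitProb_of_notMem {A B : Set Ω} (hA : MeasurableSet A) (hB : MeasurableSet B) {x : Ω}
    (hx : x ∈ (A ∪ B)ᶜ) : hitProb k A B x = ∫⁻ y, hitProb k A B y ∂(jumpKernel k x) := by
  rw [hitProb_eq_add k hA hB, killedOperator, Set.indicator_of_mem hx,
    Set.indicator_of_notMem fun h => hx (Or.inl h), zero_add]

/-- The measurable version of the harmonic function which is built from the jump chain. -/
noncomputable def chainHarmonic (A B : Set Ω) (x : Ω) : ℝ := (hitProb k A B x).toReal

lemma measurable_chainHarmonic {A B : Set Ω} (hA : MeasurableSet A) (hB : MeasurableSet B) :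
    Measurable (chainHarmonic k A B) := (measurable_hitProb k hA hB).ennreal_toReal

lemma chainHarmonic_nonneg (A B : Set Ω) (x : Ω) : 0 ≤ chainHarmonic k A B x :=
  ENNReal.toReal_nonneg

lemma chainHarmonic_le_one (A B : Set Ω) (x : Ω) : chainHarmonic k A B x ≤ 1 :=
  ENNReal.toReal_le_of_le_ofReal zero_le_one (by simpa using hitProb_le_one k A B x)

lemma chainHarmonic_of_mem_left {A B : Set Ω} (hA : MeasurableSet A) (hB : MeasurableSet B)
    {x : Ω} (hx : x ∈ A) : chainHarmonic k A B x = 1 := by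
  simp [chainHarmonic, hitProb_of_mem_left k hA hB hx]

lemma chainHarmonic_of_mem_right {A B : Set Ω} (hA : MeasurableSet A) (hB : MeasurableSet B)
    (hAB : Disjoint A B) {x : Ω} (hx : x ∈ B) : chainHarmonic k A B x = 0 := by
  simp [chainHarmonic, hitProb_of_mem_right k hA hB hAB hx]

lemma chainHarmonic_of_notMem {A B : Set Ω} (hA : MeasurableSet A) (hB : MeasurableSet B) {x : Ω}
    (hx : x ∈ (A ∪ B)ᶜ) :
    chainHarmonic k A B x = ∫ y, chainHarmonic k A B y ∂(jumpKernel k x) := by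
  have h := integral_toReal (μ := jumpKernel k x) (f := hitProb k A B)
    (measurable_hitProb k hA hB).aemeasurable
    (ae_of_all _ fun y => (hitProb_le_one k A B y).trans_lt ENNReal.one_lt_top)
  unfold chainHarmonic
  rw [h, ← hitProb_of_notMem k hA hB hx]

lemma harmonicFunction_eq_chainHarmonic (hk : ∀ x, k x Set.univ ≠ ∞) {A B : Set Ω}
    (hA : MeasurableSet A) (hB : MeasurableSet B) (hAB : Disjoint A B) {x : Ω}
    (hx : ∀ᵐ Y ∂(chainLaw (jumpKernel k) x), ∀ i, k (Y i) Set.univ ≠ 0) :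
    harmonicFunction k A B x = chainHarmonic k A B x := by
  unfold harmonicFunction
  split_ifs with h1 h2
  · exact (chainHarmonic_of_mem_left k hA hB h1).symm
  · exact (chainHarmonic_of_mem_right k hA hB hAB h2).symm
  · rw [Measure.real, jumpLaw_hitTime_lt k hk hAB hx]
    rfl

end Jump

/-! ### Equilibrium potentials, energy and flux -/

section Dirichlet

variable {Ω : Type*} [MeasurableSpace Ω]

/-- `g` is the equilibrium potential of the condenser `(A, B)` in the network with the symmetric
conductance measure `K`, and `c` is the total flux out of `A`. -/
structure IsEquilibrium (K : Measure (Ω × Ω)) (A B : Set Ω) (g : Ω → ℝ) (c : ℝ) : Prop where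
  symm : K.map Prod.swap = K
  measurable : Measurable g
  nonneg : ∀ x, 0 ≤ g x
  le_one : ∀ x, g x ≤ 1
  eq_one : ∀ x ∈ A, g x = 1
  eq_zero : ∀ x ∈ B, g x = 0
  divergence : ∀ C, MeasurableSet C → C ⊆ (A ∪ B)ᶜ →
    ∫ p in C ×ˢ Set.univ, (g p.1 - g p.2) ∂K = 0
  flux_left : ∫ p in A ×ˢ Set.univ, (g p.1 - g p.2) ∂K = c
  energy : ∫ p, (g p.1 - g p.2) ^ 2 ∂K = 2 * c

lemma integral_swap_of_symm {K : Measure (Ω × Ω)} (hK : K.map Prod.swap = K) (f : Ω × Ω → ℝ) :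
    ∫ p, f p.swap ∂K = ∫ p, f p ∂K := by
  conv_rhs => rw [← hK]
  exact (integral_map_equiv (MeasurableEquiv.prodComm (α := Ω) (β := Ω)) f).symm

lemma lintegral_swap_of_symm {K : Measure (Ω × Ω)} (hK : K.map Prod.swap = K)
    (f : Ω × Ω → ℝ≥0∞) : ∫⁻ p, f p.swap ∂K = ∫⁻ p, f p ∂K := by
  conv_rhs => rw [← hK]
  exact (lintegral_map_equiv f (MeasurableEquiv.prodComm (α := Ω) (β := Ω))).symm

lemma setIntegral_swap_of_symm {K : Measure (Ω × Ω)} (hK : K.map Prod.swap = K)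
    {f : Ω × Ω → ℝ} {S T : Set Ω} (hS : MeasurableSet S) (hT : MeasurableSet T) :
    ∫ p in S ×ˢ T, f p.swap ∂K = ∫ p in T ×ˢ S, f p ∂K := by
  rw [← integral_indicator (hS.prod hT), ← integral_indicator (hT.prod hS),
    ← integral_swap_of_symm hK ((T ×ˢ S).indicator f)]
  congr 1 with p
  have hiff : p.swap ∈ T ×ˢ S ↔ p ∈ S ×ˢ T := and_comm
  by_cases hp : p ∈ S ×ˢ T
  · rw [Set.indicator_of_mem hp, Set.indicator_of_mem (hiff.2 hp)]
  · rw [Set.indicator_of_notMem hp, Set.indicator_of_notMem fun h => hp (hiff.1 h)]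

lemma integrable_of_bound {K : Measure (Ω × Ω)} [IsFiniteMeasure K] {f : Ω × Ω → ℝ}
    (hf : Measurable f) {M : ℝ} (hM : ∀ p, |f p| ≤ M) : Integrable f K :=
  Integrable.of_bound hf.aestronglyMeasurable M (ae_of_all _ hM)

/-- The potential of a reversible chain with stationary law `π`, which is harmonic off `A ∪ B`. -/
lemma isEquilibrium_of_harmonic {π : Measure Ω} [IsFiniteMeasure π] {P : Kernel Ω Ω}
    [IsMarkovKernel P] (hK : (π.compProd P).map Prod.swap = π.compProd P) {A B : Set Ω}
    (hA : MeasurableSet A) (hB : MeasurableSet B)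
    {g : Ω → ℝ} (hg : Measurable g) (hg0 : ∀ x, 0 ≤ g x) (hg1 : ∀ x, g x ≤ 1)
    (hgA : ∀ x ∈ A, g x = 1) (hgB : ∀ x ∈ B, g x = 0)
    (hh : ∀ x ∈ (A ∪ B)ᶜ, g x = ∫ y, g y ∂P x) :
    IsEquilibrium (π.compProd P) A B g
      (∫ p in A ×ˢ Set.univ, (g p.1 - g p.2) ∂(π.compProd P)) := by
  have hD : Measurable fun p : Ω × Ω => g p.1 - g p.2 := by fun_prop
  have hDb : ∀ p : Ω × Ω, |g p.1 - g p.2| ≤ 1 := fun p => abs_sub_le_iff.2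
    ⟨by linarith [hg0 p.2, hg1 p.1], by linarith [hg0 p.1, hg1 p.2]⟩
  have hDi : Integrable (fun p : Ω × Ω => g p.1 - g p.2) (π.compProd P) :=
    integrable_of_bound hD hDb
  have hgDi : Integrable (fun p : Ω × Ω => g p.1 * (g p.1 - g p.2)) (π.compProd P) := by
    refine integrable_of_bound (M := 1) (by fun_prop) fun p => ?_
    rw [abs_mul, abs_of_nonneg (hg0 _)]
    exact mul_le_one₀ (hg1 _) (abs_nonneg _) (hDb p)
  -- The weight `a = 1` gives the divergence condition, `a = g` the summation by parts for the
  -- energy.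
  have hdiv : ∀ a : Ω → ℝ, ∀ C, MeasurableSet C → C ⊆ (A ∪ B)ᶜ →
      Integrable (fun p : Ω × Ω => a p.1 * (g p.1 - g p.2)) (π.compProd P) →
      ∫ p in C ×ˢ Set.univ, a p.1 * (g p.1 - g p.2) ∂(π.compProd P) = 0 := by
    intro a C hC hCU hi
    rw [Measure.setIntegral_compProd hC .univ hi.integrableOn]
    refine (setIntegral_congr_fun hC fun x hx => ?_).trans (integral_zero _ _)
    have hgi : Integrable g (P x) := Integrable.of_bound hg.aestronglyMeasurable 1
      (ae_of_all _ fun y => by rw [Real.norm_eq_abs, abs_of_nonneg (hg0 y)]; exact hg1 y)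
    simp only [Measure.restrict_univ]
    rw [integral_const_mul, integral_sub (integrable_const _) hgi, ← hh x (hCU hx)]
    simp
  refine ⟨hK, hg, hg0, hg1, hgA, hgB, fun C hC hCU => ?_, rfl, ?_⟩
  · simpa using hdiv (fun _ => 1) C hC hCU (by simpa using hDi)
  · have hgDi' : Integrable (fun p : Ω × Ω => g p.2 * (g p.1 - g p.2)) (π.compProd P) := by
      refine integrable_of_bound (M := 1) (by fun_prop) fun p => ?_
      rw [abs_mul, abs_of_nonneg (hg0 _)]
      exact mul_le_one₀ (hg1 _) (abs_nonneg _) (hDb p)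
    have h1 : ∫ p, g p.2 * (g p.1 - g p.2) ∂(π.compProd P) =
        -∫ p, g p.1 * (g p.1 - g p.2) ∂(π.compProd P) := by
      rw [← integral_swap_of_symm hK, ← integral_neg]
      congr 1 with p
      simp only [Prod.fst_swap, Prod.snd_swap]; ring
    have h2 : ∫ p, (g p.1 - g p.2) ^ 2 ∂(π.compProd P) =
        2 * ∫ p, g p.1 * (g p.1 - g p.2) ∂(π.compProd P) := by
      rw [two_mul]
      nth_rw 2 [← neg_neg (∫ p, g p.1 * (g p.1 - g p.2) ∂(π.compProd P))]
      rw [← h1, ← sub_eq_add_neg, ← integral_sub hgDi hgDi']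
      congr 1 with p
      ring
    -- Starting points off `A ∪ B` contribute nothing by harmonicity, those in `B` because `g = 0`
    -- there; on `A` the factor `g` is `1`, which leaves the flux.
    have h3 : ∫ p, g p.1 * (g p.1 - g p.2) ∂(π.compProd P) =
        ∫ p in A ×ˢ Set.univ, g p.1 * (g p.1 - g p.2) ∂(π.compProd P) := by
      have hs : MeasurableSet (A ×ˢ (Set.univ : Set Ω)) := hA.prod .univ
      rw [← integral_add_compl hs hgDi]
      have hc : (A ×ˢ (Set.univ : Set Ω))ᶜ = Aᶜ ×ˢ Set.univ := by
        ext; simp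
      have hU : MeasurableSet (Aᶜ \ B) := hA.compl.diff hB
      have h4 : ∫ p in Aᶜ ×ˢ Set.univ, g p.1 * (g p.1 - g p.2) ∂(π.compProd P) =
          ∫ p in (Aᶜ \ B) ×ˢ Set.univ, g p.1 * (g p.1 - g p.2) ∂(π.compProd P) := by
        refine (setIntegral_eq_of_subset_of_forall_sdiff_eq_zero (hA.compl.prod .univ)
          (Set.prod_mono Set.sdiff_subset subset_rfl) ?_)
        rintro p ⟨hp1, hp2⟩
        have : p.1 ∈ B := by
          by_contra hB'
          exact hp2 ⟨⟨hp1.1, hB'⟩, trivial⟩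
        simp [hgB _ this]
      rw [hc, h4, hdiv g _ hU (fun x hx hx' => hx'.elim hx.1 hx.2) hgDi, add_zero]
    rw [h2, h3]
    congr 1
    refine setIntegral_congr_fun (hA.prod .univ) fun p hp => ?_
    simp only [hgA _ hp.1, one_mul]

/-! ### Stationarity of the jump chain; the harmonic function as equilibrium potential -/

section Conductance

variable {k : Kernel Ω Ω} [IsSFiniteKernel k] {μ : Measure Ω} [SigmaFinite μ]

/-- The stationary measure `k (x, Ω) μ (dx)` of the jump chain. -/
noncomputable def jumpMeasure (k : Kernel Ω Ω) (μ : Measure Ω) : Measure Ω :=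
  μ.withDensity fun x => k x Set.univ

lemma measurable_rate (k : Kernel Ω Ω) : Measurable fun x => k x Set.univ :=
  Kernel.measurable_coe k MeasurableSet.univ

instance : SFinite (jumpMeasure k μ) := by unfold jumpMeasure; infer_instance

lemma conductance_eq_compProd (hk : ∀ x, k x Set.univ ≠ ∞) :
    conductance k μ = (jumpMeasure k μ).compProd (jumpKernel k) := by
  ext s hs
  rw [conductance, Measure.compProd_apply hs, Measure.compProd_apply hs, jumpMeasure,
    lintegral_withDensity_eq_lintegral_mul _ (measurable_rate k)
      (Kernel.measurable_kernel_prodMk_left hs)]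
  refine lintegral_congr fun x => ?_
  simp only [Pi.mul_apply]
  -- At absorbing states the default `δ_x` of `jumpKernel` is harmless: the density of `jumpMeasure`
  -- vanishes there.
  by_cases h0 : k x Set.univ = 0
  · rw [h0, zero_mul]
    exact measure_mono_null (Set.subset_univ _) h0
  · have : jumpKernel k x = (k x Set.univ)⁻¹ • k x := by
      change (if _ then _ else _) = _
      rw [if_neg (by simp [h0, hk x])]
    rw [this, Measure.smul_apply, smul_eq_mul, ← mul_assoc, ENNReal.mul_inv_cancel h0 (hk x),
      one_mul]

lemma fst_conductance (hk : ∀ x, k x Set.univ ≠ ∞) :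
    (conductance k μ).fst = jumpMeasure k μ := by
  rw [conductance_eq_compProd hk, Measure.fst_compProd]

lemma snd_conductance (hk : ∀ x, k x Set.univ ≠ ∞) (hrev : IsReversible k μ) :
    (conductance k μ).snd = jumpMeasure k μ := by
  rw [← fst_conductance hk, ← hrev, Measure.snd_map_swap, hrev]

/-- Stationarity: the two marginals of a symmetric measure coincide. -/
lemma jumpMeasure_bind (hk : ∀ x, k x Set.univ ≠ ∞) (hrev : IsReversible k μ) :
    (jumpMeasure k μ).bind (jumpKernel k) = jumpMeasure k μ := by
  conv_rhs => rw [← snd_conductance hk hrev, conductance_eq_compProd hk, Measure.snd_compProd]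

lemma jumpMeasure_absolutelyContinuous : jumpMeasure k μ ≪ μ :=
  withDensity_absolutelyContinuous _ _

lemma absolutelyContinuous_jumpMeasure (hpos : ∀ᵐ x ∂μ, 0 < k x Set.univ) :
    μ ≪ jumpMeasure k μ :=
  withDensity_absolutelyContinuous' (measurable_rate k).aemeasurable
    (hpos.mono fun _ h => h.ne')

lemma isFiniteMeasure_conductance (hfin : conductance k μ Set.univ ≠ ∞) :
    IsFiniteMeasure (conductance k μ) := ⟨hfin.lt_top⟩

lemma isFiniteMeasure_jumpMeasure (hk : ∀ x, k x Set.univ ≠ ∞)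
    (hfin : conductance k μ Set.univ ≠ ∞) : IsFiniteMeasure (jumpMeasure k μ) := by
  have := isFiniteMeasure_conductance hfin
  rw [← fst_conductance hk]
  infer_instance

/-- A property of the jumps which holds almost everywhere for the conductance measure holds at all
times, for almost every starting point. -/
lemma ae_ae_forall_of_ae_conductance (hk : ∀ x, k x Set.univ ≠ ∞)
    (hpos : ∀ᵐ x ∂μ, 0 < k x Set.univ) (hrev : IsReversible k μ) {Q : Ω × Ω → Prop}
    (hQ : ∀ᵐ p ∂(conductance k μ), Q p) :
    ∀ᵐ x ∂μ, ∀ᵐ Y ∂(chainLaw (jumpKernel k) x), ∀ n, Q (Y n, Y (n + 1)) := by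
  rw [conductance_eq_compProd hk] at hQ
  -- No killing: `S` is the whole space, and the stationary measure is both the initial law and the
  -- dominating measure.
  have h := ae_forall_stayBefore_of_ae (jumpKernel k) (m := jumpMeasure k μ) MeasurableSet.univ
    (by rw [Measure.restrict_univ]) (by rw [Measure.restrict_univ, jumpMeasure_bind hk hrev]) hQ
  refine (absolutelyContinuous_jumpMeasure hpos).ae_le ?_
  filter_upwards [Measure.ae_ae_of_ae_comp h] with x hx
  filter_upwards [hx] with Y hY n
  exact hY n fun _ _ => trivial

lemma ae_regular (hk : ∀ x, k x Set.univ ≠ ∞)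
    (hpos : ∀ᵐ x ∂μ, 0 < k x Set.univ) (hrev : IsReversible k μ) :
    ∀ᵐ x ∂μ, ∀ᵐ Y ∂(chainLaw (jumpKernel k) x), ∀ n, k (Y n) Set.univ ≠ 0 := by
  refine ae_ae_forall_of_ae_conductance hk hpos hrev (Q := fun p => k p.1 Set.univ ≠ 0) ?_
  have h : ∀ᵐ x ∂(conductance k μ).fst, k x Set.univ ≠ 0 := by
    rw [fst_conductance hk]
    exact jumpMeasure_absolutelyContinuous.ae_le (hpos.mono fun _ h => h.ne')
  exact ae_of_ae_map measurable_fst.aemeasurable h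

lemma harmonicFunction_ae_eq (hk : ∀ x, k x Set.univ ≠ ∞)
    (hpos : ∀ᵐ x ∂μ, 0 < k x Set.univ) (hrev : IsReversible k μ) {A B : Set Ω}
    (hA : MeasurableSet A) (hB : MeasurableSet B) (hAB : Disjoint A B) :
    harmonicFunction k A B =ᵐ[μ] chainHarmonic k A B := by
  filter_upwards [ae_regular hk hpos hrev] with x hx
  exact harmonicFunction_eq_chainHarmonic k hk hA hB hAB hx

lemma harmonicFunction_fst_snd_ae_eq (hk : ∀ x, k x Set.univ ≠ ∞)
    (hpos : ∀ᵐ x ∂μ, 0 < k x Set.univ) (hrev : IsReversible k μ) {A B : Set Ω}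
    (hA : MeasurableSet A) (hB : MeasurableSet B) (hAB : Disjoint A B) :
    ∀ᵐ p ∂(conductance k μ), harmonicFunction k A B p.1 = chainHarmonic k A B p.1 ∧
      harmonicFunction k A B p.2 = chainHarmonic k A B p.2 := by
  have h := (jumpMeasure_absolutelyContinuous (k := k)).ae_le
    (harmonicFunction_ae_eq hk hpos hrev hA hB hAB)
  have h1 : ∀ᵐ x ∂(conductance k μ).fst, harmonicFunction k A B x = chainHarmonic k A B x := by
    rwa [fst_conductance hk]
  have h2 : ∀ᵐ x ∂(conductance k μ).snd, harmonicFunction k A B x = chainHarmonic k A B x := by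
    rwa [snd_conductance hk hrev]
  exact (ae_of_ae_map measurable_fst.aemeasurable h1).and
    (ae_of_ae_map measurable_snd.aemeasurable h2)

/-- Inside the generator the function is evaluated at `x` and at `k x`-almost every `y`, so
agreement is needed at both endpoints of almost every edge. -/
lemma capacity_eq_setIntegral (hk : ∀ x, k x Set.univ ≠ ∞)
    (hpos : ∀ᵐ x ∂μ, 0 < k x Set.univ) (hrev : IsReversible k μ)
    (hfin : conductance k μ Set.univ ≠ ∞) {A B : Set Ω}
    (hA : MeasurableSet A) (hB : MeasurableSet B) (hAB : Disjoint A B) :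
    capacity k μ A B = ∫ p in A ×ˢ Set.univ,
      (chainHarmonic k A B p.1 - chainHarmonic k A B p.2) ∂(conductance k μ) := by
  have := isFiniteMeasure_conductance hfin
  have hg := measurable_chainHarmonic k hA hB
  have hDi : Integrable (fun p : Ω × Ω => chainHarmonic k A B p.1 - chainHarmonic k A B p.2)
      (conductance k μ) := by
    refine integrable_of_bound (M := 1) (by fun_prop) fun p => abs_sub_le_iff.2 ⟨?_, ?_⟩ <;>
    linarith [chainHarmonic_nonneg k A B p.1, chainHarmonic_le_one k A B p.1,
      chainHarmonic_nonneg k A B p.2, chainHarmonic_le_one k A B p.2]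
  rw [capacity, conductance, Measure.setIntegral_compProd hA .univ hDi.integrableOn]
  have hae := Measure.ae_ae_of_ae_compProd
    (harmonicFunction_fst_snd_ae_eq hk hpos hrev hA hB hAB)
  refine integral_congr_ae (ae_restrict_of_ae ?_)
  filter_upwards [hae, harmonicFunction_ae_eq hk hpos hrev hA hB hAB] with x hx hx'
  rw [generator, ← integral_neg, Measure.restrict_univ]
  refine integral_congr_ae ?_
  filter_upwards [hx] with y hy
  rw [hy.1, hy.2]; ring

lemma isEquilibrium_chainHarmonic (hk : ∀ x, k x Set.univ ≠ ∞)
    (hpos : ∀ᵐ x ∂μ, 0 < k x Set.univ) (hrev : IsReversible k μ)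
    (hfin : conductance k μ Set.univ ≠ ∞) {A B : Set Ω}
    (hA : MeasurableSet A) (hB : MeasurableSet B) (hAB : Disjoint A B) :
    IsEquilibrium (conductance k μ) A B (chainHarmonic k A B) (capacity k μ A B) := by
  have := isFiniteMeasure_jumpMeasure hk hfin
  rw [capacity_eq_setIntegral hk hpos hrev hfin hA hB hAB]
  unfold IsReversible at hrev
  rw [conductance_eq_compProd hk] at hrev ⊢
  exact isEquilibrium_of_harmonic hrev hA hB (measurable_chainHarmonic k hA hB)
    (chainHarmonic_nonneg k A B) (chainHarmonic_le_one k A B)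
    (fun x hx => chainHarmonic_of_mem_left k hA hB hx)
    (fun x hx => chainHarmonic_of_mem_right k hA hB hAB hx)
    (fun x hx => chainHarmonic_of_notMem k hA hB hx)

end Conductance

namespace IsEquilibrium

variable {K : Measure (Ω × Ω)} [IsFiniteMeasure K] {A B : Set Ω} {g : Ω → ℝ} {c : ℝ}

lemma abs_sub_le (h : IsEquilibrium K A B g c) (p : Ω × Ω) : |g p.1 - g p.2| ≤ 1 :=
  abs_sub_le_iff.2 ⟨by linarith [h.nonneg p.2, h.le_one p.1],
    by linarith [h.nonneg p.1, h.le_one p.2]⟩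

lemma measurable_sub (h : IsEquilibrium K A B g c) :
    Measurable fun p : Ω × Ω => g p.1 - g p.2 :=
  (h.measurable.comp measurable_fst).sub (h.measurable.comp measurable_snd)

lemma integrable_sub (h : IsEquilibrium K A B g c) :
    Integrable (fun p : Ω × Ω => g p.1 - g p.2) K :=
  integrable_of_bound h.measurable_sub h.abs_sub_le

lemma integrable_sub_sq (h : IsEquilibrium K A B g c) :
    Integrable (fun p : Ω × Ω => (g p.1 - g p.2) ^ 2) K :=
  integrable_of_bound (M := 1) (h.measurable_sub.pow_const 2) fun p => by
    rw [abs_pow]; exact pow_le_one₀ (abs_nonneg _) (h.abs_sub_le p)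

lemma flux_nonneg (h : IsEquilibrium K A B g c) : 0 ≤ c := by
  have : 0 ≤ ∫ p, (g p.1 - g p.2) ^ 2 ∂K := integral_nonneg fun p => sq_nonneg _
  rw [h.energy] at this
  linarith

lemma ae_eq_of_flux_eq_zero (h : IsEquilibrium K A B g c) (hc : c = 0) :
    ∀ᵐ p ∂K, g p.1 = g p.2 := by
  have h0 : ∫ p, (g p.1 - g p.2) ^ 2 ∂K = 0 := by rw [h.energy, hc, mul_zero]
  rw [integral_eq_zero_iff_of_nonneg (fun p => sq_nonneg _) h.integrable_sub_sq] at h0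
  filter_upwards [h0] with p hp
  exact sub_eq_zero.1 (pow_eq_zero_iff two_ne_zero |>.1 hp)

lemma setIntegral_swap (h : IsEquilibrium K A B g c) {S T : Set Ω} (hS : MeasurableSet S)
    (hT : MeasurableSet T) :
    ∫ p in S ×ˢ T, (g p.1 - g p.2) ∂K = -∫ p in T ×ˢ S, (g p.1 - g p.2) ∂K := by
  rw [← setIntegral_swap_of_symm h.symm hT hS, ← integral_neg]
  congr 1 with p
  simp

/-- By antisymmetry the total flux is zero, and by harmonicity none leaves the complement of `A ∪
B`; so the flux out of `B` is `-c`. -/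
lemma flux_right (h : IsEquilibrium K A B g c) (hA : MeasurableSet A) (hB : MeasurableSet B)
    (hAB : Disjoint A B) : ∫ p in Set.univ ×ˢ B, (g p.1 - g p.2) ∂K = c := by
  have hU := (hA.union hB).compl
  have h0 : ∫ p, (g p.1 - g p.2) ∂K = 0 := by
    have := h.setIntegral_swap (S := Set.univ) (T := Set.univ) .univ .univ
    simp only [Set.univ_prod_univ, Measure.restrict_univ] at this
    linarith
  have hsplit : (Set.univ : Set (Ω × Ω)) =
      (A ×ˢ Set.univ ∪ B ×ˢ Set.univ) ∪ (A ∪ B)ᶜ ×ˢ Set.univ := by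
    rw [← Set.union_prod, ← Set.union_prod, Set.union_compl_self, Set.univ_prod_univ]
  rw [← setIntegral_univ, hsplit, setIntegral_union, setIntegral_union, h.flux_left,
    h.divergence _ hU subset_rfl, h.setIntegral_swap hB .univ] at h0
  · linarith
  · exact Set.disjoint_prod.2 (Or.inl hAB)
  · exact hB.prod .univ
  · exact h.integrable_sub.integrableOn
  · exact h.integrable_sub.integrableOn
  · rw [← Set.union_prod]
    exact Set.disjoint_prod.2 (Or.inl disjoint_compl_right)
  · exact hU.prod .univ
  · exact h.integrable_sub.integrableOn
  · exact h.integrable_sub.integrableOn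

end IsEquilibrium

/-! ### When the capacity is positive and when it vanishes -/

section Positivity

variable {k : Kernel Ω Ω} [IsSFiniteKernel k] {μ : Measure Ω} [SigmaFinite μ]

/-- Zero capacity means zero energy, so `g` is constant along the trajectories from almost every
start. From `A` it keeps the value `1`, so `B` is never reached, against irreducibility. -/
lemma capacity_pos (hk : ∀ x, k x Set.univ ≠ ∞)
    (hpos : ∀ᵐ x ∂μ, 0 < k x Set.univ) (hrev : IsReversible k μ)
    (hirr : IsIrreducible k μ) (hfin : conductance k μ Set.univ ≠ ∞) {A B : Set Ω}
    (hA : MeasurableSet A) (hB : MeasurableSet B) (hAB : Disjoint A B)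
    (hμA : 0 < μ A) (hμB : 0 < μ B) : 0 < capacity k μ A B := by
  have := isFiniteMeasure_conductance hfin
  have heq := isEquilibrium_chainHarmonic hk hpos hrev hfin hA hB hAB
  refine heq.flux_nonneg.lt_of_ne fun h0 => hμA.ne' ?_
  have hconst := ae_ae_forall_of_ae_conductance hk hpos hrev (heq.ae_eq_of_flux_eq_zero h0.symm)
  have hhit := ae_pos_chainLaw_exists_mem k hirr hB hμB
  refine measure_mono_null ?_ (ae_iff.1 (hconst.and hhit))
  rintro x hx ⟨h1, h2⟩
  refine h2.ne' (measure_eq_zero_iff_ae_notMem.2 ?_)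
  filter_upwards [h1, ae_chainLaw_zero_mem (jumpKernel k) hA hx] with Y hY hY0
  rintro ⟨n, hn⟩
  have hall : ∀ m, chainHarmonic k A B (Y m) = 1 := by
    intro m
    induction m with
    | zero => exact heq.eq_one _ hY0
    | succ m ih => rw [← hY m, ih]
  have := heq.eq_zero _ hn
  rw [hall n] at this
  exact one_ne_zero this

lemma capacity_eq_zero_of_left (A B : Set Ω) (hμA : μ A = 0) : capacity k μ A B = 0 := by
  rw [capacity, Measure.restrict_eq_zero.2 hμA, integral_zero_measure]

lemma capacity_eq_zero_of_right (hk : ∀ x, k x Set.univ ≠ ∞)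
    (hpos : ∀ᵐ x ∂μ, 0 < k x Set.univ) (hrev : IsReversible k μ)
    (hfin : conductance k μ Set.univ ≠ ∞) {A B : Set Ω}
    (hA : MeasurableSet A) (hB : MeasurableSet B) (hAB : Disjoint A B) (hμB : μ B = 0) :
    capacity k μ A B = 0 := by
  have := isFiniteMeasure_conductance hfin
  have heq := isEquilibrium_chainHarmonic hk hpos hrev hfin hA hB hAB
  rw [← heq.flux_right hA hB hAB]
  refine setIntegral_measure_zero _ ?_
  rw [Set.univ_prod, ← Measure.snd_apply hB, snd_conductance hk hrev]
  exact jumpMeasure_absolutelyContinuous hμB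

end Positivity

end Dirichlet

/-! ### Unit flows: the energy bound and the flow that attains it -/

section Flow

variable {Ω : Type*} [MeasurableSpace Ω] {A B : Set Ω} {K Φ : Measure (Ω × Ω)}

lemma chainHitTime_eq {Y : ℕ → Ω} {N : ℕ} (h0 : Y 0 ∉ B) (hN : Y N ∈ B)
    (hlt : ∀ m < N, Y m ∉ B) : chainHitTime B Y = N := by
  have hpos : 1 ≤ N := by
    rcases N with _ | N
    · exact absurd hN h0
    · omega
  refine le_antisymm (iInf₂_le N ⟨hpos, hN⟩) (le_iInf₂ fun n hn => ?_)
  rw [Nat.cast_le]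
  by_contra! h
  exact hlt n h hn.2

lemma pathResistance_eq_sum {Y : ℕ → Ω} {N : ℕ} (h0 : Y 0 ∉ B) (hN : Y N ∈ B)
    (hlt : ∀ m < N, Y m ∉ B) :
    pathResistance B K Φ Y = ∑ n ∈ Finset.range N, Φ.rnDeriv K (Y n, Y (n + 1)) := by
  rw [pathResistance, chainHitTime_eq h0 hN hlt, tsum_eq_sum (s := Finset.range N)]
  · refine Finset.sum_congr rfl fun n hn => if_pos ?_
    rw [Nat.cast_le]
    exact Finset.mem_range.1 hn
  · intro n hn
    refine if_neg ?_
    rw [Nat.cast_le]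
    simpa using hn

/-- Cauchy–Schwarz: the energy of a potential drop of one along a path dominates the conductance of
the path. -/
lemma inv_sum_le_sum_div {a : ℕ → ℝ} {φ : ℕ → ℝ≥0∞} {N : ℕ}
    (hφ : ∀ n < N, φ n ≠ 0 ∧ φ n ≠ ∞) (ha : ∑ n ∈ Finset.range N, a n = 1) :
    (∑ n ∈ Finset.range N, φ n)⁻¹ ≤
      ∑ n ∈ Finset.range N, ENNReal.ofReal (a n ^ 2) / φ n := by
  have hpos : ∀ n ∈ Finset.range N, 0 < (φ n).toReal := fun n hn =>
    ENNReal.toReal_pos (hφ n (Finset.mem_range.1 hn)).1 (hφ n (Finset.mem_range.1 hn)).2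
  have hne : (Finset.range N).Nonempty := by
    by_contra h
    rw [Finset.not_nonempty_iff_eq_empty] at h
    simp [h] at ha
  have hsum : 0 < ∑ n ∈ Finset.range N, (φ n).toReal := Finset.sum_pos hpos hne
  have h1 : ∑ n ∈ Finset.range N, φ n =
      ENNReal.ofReal (∑ n ∈ Finset.range N, (φ n).toReal) := by
    rw [ENNReal.ofReal_sum_of_nonneg fun n hn => (hpos n hn).le]
    exact Finset.sum_congr rfl fun n hn =>
      (ENNReal.ofReal_toReal (hφ n (Finset.mem_range.1 hn)).2).symm
  have h2 : ∑ n ∈ Finset.range N, ENNReal.ofReal (a n ^ 2) / φ n =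
      ENNReal.ofReal (∑ n ∈ Finset.range N, a n ^ 2 / (φ n).toReal) := by
    rw [ENNReal.ofReal_sum_of_nonneg fun n hn => div_nonneg (sq_nonneg _) (hpos n hn).le]
    refine Finset.sum_congr rfl fun n hn => ?_
    rw [ENNReal.ofReal_div_of_pos (hpos n hn),
      ENNReal.ofReal_toReal (hφ n (Finset.mem_range.1 hn)).2]
  -- Cauchy–Schwarz for the factorization `a² = φ * (a² / φ)`.
  have hcs := Finset.sum_sq_le_sum_mul_sum_of_sq_le_mul (Finset.range N) (r := a)
    (f := fun n => (φ n).toReal) (g := fun n => a n ^ 2 / (φ n).toReal)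
    (fun n hn => (hpos n hn).le) (fun n hn => div_nonneg (sq_nonneg _) (hpos n hn).le)
    (fun n hn => (mul_div_cancel₀ _ (hpos n hn).ne').ge)
  rw [h1, h2, ← ENNReal.ofReal_inv_of_pos hsum]
  refine ENNReal.ofReal_le_ofReal ?_
  rw [inv_le_iff_one_le_mul₀ hsum, mul_comm]
  simpa [ha] using hcs

section UnitFlow

variable {κ : Kernel Ω Ω} [IsMarkovKernel κ] [IsFiniteMeasure Φ]

/-- The supersolution property needed for comparison with the chain killed on `B`. Off `A ∪ B`
inflow equals outflow; nothing flows into `A`, where the initial law supplies the outflow. -/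
lemma IsUnitFlow.restrict_le (hΦ : IsUnitFlow A B Φ) (hA : MeasurableSet A)
    (hB : MeasurableSet B) (hκ : Φ = Φ.fst.compProd κ) :
    (Φ.fst.restrict A + Φ.fst.bind κ).restrict Bᶜ ≤ Φ.fst := by
  have hsnd : Φ.fst.bind κ = Φ.snd := by
    conv_rhs => rw [hκ, Measure.snd_compProd]
  rw [hsnd]
  refine Measure.le_iff.2 fun s hs => ?_
  have hC := hs.inter hB.compl
  rw [Measure.restrict_apply hs, Measure.add_apply, Measure.restrict_apply hC]
  have h1 : Φ.snd (s ∩ Bᶜ) = Φ.fst ((s ∩ Bᶜ) \ A) := by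
    rw [← measure_inter_add_sdiff (μ := Φ.snd) (s ∩ Bᶜ) hA,
      measure_mono_null Set.inter_subset_right
        (by rw [Measure.snd_apply hA, ← Set.univ_prod]; exact hΦ.into_A), zero_add,
      Measure.snd_apply (hC.diff hA), Measure.fst_apply (hC.diff hA), ← Set.univ_prod,
      ← Set.prod_univ]
    refine hΦ.kirchhoff _ (hC.diff hA) fun x hx hx' => ?_
    exact hx'.elim hx.2 hx.1.2
  rw [h1, measure_inter_add_sdiff _ hA]
  exact measure_mono Set.inter_subset_left

lemma IsUnitFlow.tsum_setLIntegral_le (hΦ : IsUnitFlow A B Φ) (hA : MeasurableSet A)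
    (hB : MeasurableSet B) (hκ : Φ = Φ.fst.compProd κ) {w : Ω × Ω → ℝ≥0∞} (hw : Measurable w) :
    ∑' n, ∫⁻ Y in stayBefore Bᶜ (n + 1), w (Y n, Y (n + 1)) ∂(flowChainLaw A Φ κ) ≤
      ∫⁻ p, w p ∂Φ := by
  refine (tsum_setLIntegral_stayBefore_le κ hB.compl (hΦ.restrict_le hA hB hκ) hw).trans ?_
  rw [← hκ]

/-- Almost every trajectory of the chain of a unit flow starts in `A` and reaches `B`, and a
property which holds `Φ`-almost everywhere holds for all its steps. -/
lemma IsUnitFlow.ae_exists_path (hΦ : IsUnitFlow A B Φ) (hA : MeasurableSet A)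
    (hB : MeasurableSet B) (hκ : Φ = Φ.fst.compProd κ) {Q : Ω × Ω → Prop}
    (hQ : ∀ᵐ p ∂Φ, Q p) :
    ∀ᵐ Y ∂(flowChainLaw A Φ κ), Y 0 ∈ A ∧
      ∃ N, Y N ∈ B ∧ (∀ m < N, Y m ∉ B) ∧ ∀ n < N, Q (Y n, Y (n + 1)) := by
  classical
  have hle := hΦ.restrict_le hA hB hκ
  rw [Measure.restrict_add] at hle
  have h0 : ∀ᵐ Y ∂(flowChainLaw A Φ κ), Y 0 ∈ A :=
    ae_bind_chainLaw_zero_mem κ hA (ae_restrict_mem hA)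
  have h1 : ∀ᵐ Y ∂(flowChainLaw A Φ κ),
      ∀ n, Y ∈ stayBefore Bᶜ (n + 1) → Q (Y n, Y (n + 1)) :=
    ae_forall_stayBefore_of_ae κ hB.compl
      (Measure.absolutelyContinuous_of_le ((Measure.le_add_right le_rfl).trans hle))
      (Measure.absolutelyContinuous_of_le ((Measure.le_add_left le_rfl).trans hle))
      (by rwa [← hκ])
  -- Borel–Cantelli: the probabilities of avoiding `B` up to time `n` sum to at most the total mass
  -- of `Φ`, which is finite.
  have h2 : ∀ᵐ Y ∂(flowChainLaw A Φ κ),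
      ∀ᶠ n in Filter.atTop, Y ∉ stayBefore Bᶜ (n + 1) := by
    refine ae_eventually_notMem (ne_top_of_le_ne_top (measure_ne_top Φ Set.univ) ?_)
    simpa using hΦ.tsum_setLIntegral_le hA hB hκ (w := fun _ => 1) measurable_const
  filter_upwards [h0, h1, h2] with Y hY0 hY1 hY2
  obtain ⟨n, hn⟩ := hY2.exists
  have hex : ∃ N, Y N ∈ B := by
    by_contra! hc
    exact hn fun m _ => hc m
  have hmin : ∀ m < Nat.find hex, Y m ∉ B := fun m hm => Nat.find_min hex hm
  exact ⟨hY0, Nat.find hex, Nat.find_spec hex, hmin,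
    fun n hn => hY1 n fun m hm => hmin m (by omega)⟩

lemma IsUnitFlow.flowChainLaw_univ (hΦ : IsUnitFlow A B Φ) (hA : MeasurableSet A) :
    flowChainLaw A Φ κ Set.univ = 1 := by
  rw [flowChainLaw, Measure.bind_apply .univ (measurable_chainLaw κ).aemeasurable]
  simp only [measure_univ, lintegral_const, one_mul, Measure.restrict_apply_univ]
  rw [Measure.fst_apply hA, ← Set.prod_univ, hΦ.out_of_A]

end UnitFlow

/-- `χ` and its reversal are disjoint and, by symmetry of `K` and `s`, carry the same integral. -/
lemma two_mul_setLIntegral_le (hK : K.map Prod.swap = K) {χ : Set (Ω × Ω)}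
    (hχm : MeasurableSet χ) (hχ : ∀ x y, (x, y) ∈ χ → (y, x) ∉ χ) {s : Ω × Ω → ℝ≥0∞}
    (hs : Measurable s) (hsymm : ∀ p, s p.swap = s p) :
    2 * ∫⁻ p in χ, s p ∂K ≤ ∫⁻ p, s p ∂K := by
  rw [two_mul, ← lintegral_indicator hχm]
  nth_rw 2 [← lintegral_swap_of_symm hK]
  rw [← lintegral_add_left (hs.indicator hχm)]
  refine lintegral_mono fun p => ?_
  by_cases h : p ∈ χ
  · have : p.swap ∉ χ := hχ p.1 p.2 h
    simp [h, this]
  · rw [Set.indicator_of_notMem h, zero_add, ← hsymm p]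
    exact Set.indicator_le_self _ _ _

variable {g : Ω → ℝ} {c : ℝ} [IsFiniteMeasure K]

/-- The energy bound: no unit flow has a larger expected path conductance than the capacity. -/
lemma IsEquilibrium.flowExpectation_le (h : IsEquilibrium K A B g c) (hA : MeasurableSet A)
    (hB : MeasurableSet B) (hAB : Disjoint A B) (hΦ : Φ ∈ unitFlows A B K) {κ : Kernel Ω Ω}
    [IsMarkovKernel κ] (hκ : Φ = Φ.fst.compProd κ) :
    flowExpectation A B K Φ κ ≤ ENNReal.ofReal c := by
  obtain ⟨hflow, hac, hfinite⟩ := hΦ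
  let s : Ω × Ω → ℝ≥0∞ := fun p => ENNReal.ofReal ((g p.1 - g p.2) ^ 2)
  have hs : Measurable s := (h.measurable_sub.pow_const 2).ennreal_ofReal
  have hφ := Measure.measurable_rnDeriv Φ K
  let w : Ω × Ω → ℝ≥0∞ := fun p => s p / Φ.rnDeriv K p
  have hw : Measurable w := hs.div hφ
  have hQ : ∀ᵐ p ∂Φ, Φ.rnDeriv K p ≠ 0 ∧ Φ.rnDeriv K p ≠ ∞ := by
    filter_upwards [Measure.rnDeriv_pos hac, hac.ae_le (Measure.rnDeriv_lt_top Φ K)] with p h1 h2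
    exact ⟨h1.ne', h2.ne⟩
  have hpath : ∀ᵐ Y ∂(flowChainLaw A Φ κ), (pathResistance B K Φ Y)⁻¹ ≤
      ∑' n, (stayBefore Bᶜ (n + 1)).indicator (fun Y => w (Y n, Y (n + 1))) Y := by
    filter_upwards [hflow.ae_exists_path hA hB hκ hQ] with Y hY
    obtain ⟨hY0, N, hN, hlt, hstep⟩ := hY
    rw [pathResistance_eq_sum (Set.disjoint_left.1 hAB hY0) hN hlt]
    refine (inv_sum_le_sum_div (a := fun n => g (Y n) - g (Y (n + 1))) hstep ?_).trans ?_
    · rw [Finset.sum_range_sub', h.eq_one _ hY0, h.eq_zero _ hN, sub_zero]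
    · refine le_trans (Finset.sum_le_sum fun n hn => ?_) (ENNReal.sum_le_tsum (Finset.range N))
      rw [Set.indicator_of_mem]
      exact fun m hm => hlt m (by have := Finset.mem_range.1 hn; omega)
  obtain ⟨χ, hχm, hχ0, hχ⟩ := hflow.oriented
  have henergy : ∫⁻ p, s p ∂K = 2 * ENNReal.ofReal c := by
    rw [← ofReal_integral_eq_lintegral_ofReal h.integrable_sub_sq
      (ae_of_all _ fun p => sq_nonneg _), h.energy, ENNReal.ofReal_mul zero_le_two,
      ENNReal.ofReal_ofNat]
  -- `Φ` is carried by `χ` and has density `φ`, which cancels the denominator of `w`; an inequality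
  -- suffices where `φ` is `0` or `∞`.
  have hle : ∫⁻ p, w p ∂Φ ≤ ∫⁻ p in χ, s p ∂K := by
    rw [← Measure.restrict_eq_self_of_ae_mem (μ := Φ) (s := χ) (ae_iff.2 hχ0)]
    nth_rw 1 [← Measure.withDensity_rnDeriv_eq Φ K hac]
    rw [setLIntegral_withDensity_eq_setLIntegral_mul _ hφ hw hχm]
    exact lintegral_mono fun p => ENNReal.mul_div_le
  calc flowExpectation A B K Φ κ
      ≤ ∫⁻ Y, ∑' n, (stayBefore Bᶜ (n + 1)).indicator (fun Y => w (Y n, Y (n + 1))) Y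
        ∂(flowChainLaw A Φ κ) := lintegral_mono_ae hpath
    _ = ∑' n, ∫⁻ Y in stayBefore Bᶜ (n + 1), w (Y n, Y (n + 1)) ∂(flowChainLaw A Φ κ) := by
        rw [lintegral_tsum]
        · exact tsum_congr fun n => lintegral_indicator (measurableSet_stayBefore hB.compl _) _
        · intro n
          refine Measurable.aemeasurable ?_
          exact Measurable.indicator (by fun_prop) (measurableSet_stayBefore hB.compl _)
    _ ≤ ∫⁻ p, w p ∂Φ := hflow.tsum_setLIntegral_le hA hB hκ hw
    _ ≤ ∫⁻ p in χ, s p ∂K := hle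
    _ ≤ ENNReal.ofReal c := by
        have h2 := two_mul_setLIntegral_le h.symm hχm hχ hs (fun p => by
          simp only [s, Prod.fst_swap, Prod.snd_swap]; congr 1; ring)
        rw [henergy] at h2
        exact (ENNReal.mul_le_mul_iff_right two_ne_zero ENNReal.ofNat_ne_top).1 h2

/-- The normalized gradient flow of a potential `g`. -/
noncomputable def gradientFlow (K : Measure (Ω × Ω)) (g : Ω → ℝ) (c : ℝ) : Measure (Ω × Ω) :=
  K.withDensity fun p => ENNReal.ofReal (max (g p.1 - g p.2) 0 / c)

namespace IsEquilibrium

lemma measurable_gradient (h : IsEquilibrium K A B g c) :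
    Measurable fun p : Ω × Ω => ENNReal.ofReal (max (g p.1 - g p.2) 0 / c) :=
  ((h.measurable_sub.max measurable_const).div_const c).ennreal_ofReal

lemma integrable_max (h : IsEquilibrium K A B g c) :
    Integrable (fun p : Ω × Ω => max (g p.1 - g p.2) 0) K :=
  h.integrable_sub.pos_part

lemma gradientFlow_apply (h : IsEquilibrium K A B g c) {S : Set (Ω × Ω)} (hS : MeasurableSet S) :
    gradientFlow K g c S = ENNReal.ofReal ((∫ p in S, max (g p.1 - g p.2) 0 ∂K) / c) := by
  rw [gradientFlow, withDensity_apply _ hS, ← integral_div,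
    ofReal_integral_eq_lintegral_ofReal (h.integrable_max.div_const c).integrableOn]
  exact ae_of_all _ fun p => div_nonneg (le_max_right _ _) h.flux_nonneg

lemma gradientFlow_eq_zero (h : IsEquilibrium K A B g c) {S : Set (Ω × Ω)}
    (hS : MeasurableSet S) (hle : ∀ p ∈ S, g p.1 ≤ g p.2) : gradientFlow K g c S = 0 := by
  rw [h.gradientFlow_apply hS, setIntegral_eq_zero_of_forall_eq_zero, zero_div,
    ENNReal.ofReal_zero]
  exact fun p hp => max_eq_right (sub_nonpos.2 (hle p hp))

lemma gradientFlow_eq_one (h : IsEquilibrium K A B g c) (hc : 0 < c) {S : Set (Ω × Ω)}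
    (hS : MeasurableSet S) (hle : ∀ p ∈ S, g p.2 ≤ g p.1)
    (hflux : ∫ p in S, (g p.1 - g p.2) ∂K = c) : gradientFlow K g c S = 1 := by
  have : ∫ p in S, max (g p.1 - g p.2) 0 ∂K = c := by
    rw [← hflux]
    exact setIntegral_congr_fun hS fun p hp => max_eq_left (sub_nonneg.2 (hle p hp))
  rw [h.gradientFlow_apply hS, this, div_self hc.ne', ENNReal.ofReal_one]

lemma isFiniteMeasure_gradientFlow (h : IsEquilibrium K A B g c) :
    IsFiniteMeasure (gradientFlow K g c) :=
  ⟨by rw [h.gradientFlow_apply .univ]; exact ENNReal.ofReal_lt_top⟩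

lemma measurableSet_descent (h : IsEquilibrium K A B g c) :
    MeasurableSet {p : Ω × Ω | g p.2 < g p.1} :=
  measurableSet_lt (h.measurable.comp measurable_snd) (h.measurable.comp measurable_fst)

lemma gradientFlow_compl_descent (h : IsEquilibrium K A B g c) :
    gradientFlow K g c {p : Ω × Ω | g p.2 < g p.1}ᶜ = 0 :=
  h.gradientFlow_eq_zero h.measurableSet_descent.compl fun _ hp => not_lt.1 hp

lemma isUnitFlow_gradientFlow (h : IsEquilibrium K A B g c) (hc : 0 < c) (hA : MeasurableSet A)
    (hB : MeasurableSet B) (hAB : Disjoint A B) : IsUnitFlow A B (gradientFlow K g c) where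
  sigmaFinite := by
    have := h.isFiniteMeasure_gradientFlow
    infer_instance
  out_of_A := h.gradientFlow_eq_one hc (hA.prod .univ)
    (fun p hp => by rw [h.eq_one _ hp.1]; exact h.le_one _) h.flux_left
  into_A := h.gradientFlow_eq_zero (MeasurableSet.univ.prod hA)
    fun p hp => by rw [h.eq_one _ hp.2]; exact h.le_one _
  into_B := h.gradientFlow_eq_one hc (MeasurableSet.univ.prod hB)
    (fun p hp => by rw [h.eq_zero _ hp.2]; exact h.nonneg _) (h.flux_right hA hB hAB)
  out_of_B := h.gradientFlow_eq_zero (hB.prod .univ)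
    fun p hp => by rw [h.eq_zero _ hp.1]; exact h.nonneg _
  kirchhoff C hC hCU := by
    rw [h.gradientFlow_apply (MeasurableSet.univ.prod hC), h.gradientFlow_apply (hC.prod .univ),
      ← setIntegral_swap_of_symm h.symm hC .univ]
    congr 2
    have hd := h.divergence C hC hCU
    -- The negative part of the drop along an edge is the positive part along the reversed edge, so
    -- zero divergence says that inflow equals outflow.
    have hmax : ∀ p : Ω × Ω, g p.1 - g p.2 =
        max (g p.1 - g p.2) 0 - max (g p.swap.1 - g p.swap.2) 0 := fun p => by
      rw [Prod.fst_swap, Prod.snd_swap, ← neg_sub (g p.1) (g p.2),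
        max_zero_sub_max_neg_zero_eq_self]
    have hint : Integrable (fun p : Ω × Ω => max (g p.swap.1 - g p.swap.2) 0) K := by
      refine h.integrable_sub.neg.pos_part.congr (ae_of_all _ fun p => ?_)
      simp only [Prod.fst_swap, Prod.snd_swap, Pi.neg_apply, neg_sub]
    rw [integral_congr_ae (ae_of_all _ hmax),
      integral_sub h.integrable_max.integrableOn hint.integrableOn] at hd
    linarith
  oriented := ⟨_, h.measurableSet_descent, h.gradientFlow_compl_descent,
    fun _ _ h1 h2 => lt_asymm (α := ℝ) h1 h2⟩

/-- The flow is carried by the edges along which `g` strictly decreases, and these cannot close up.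
-/
lemma isLoopFree_gradientFlow (h : IsEquilibrium K A B g c) :
    IsLoopFree (gradientFlow K g c) := by
  refine ⟨_, h.measurableSet_descent, h.gradientFlow_compl_descent,
    fun _ _ h1 h2 => lt_asymm (α := ℝ) h1 h2, fun n γ hn hγ => ?_⟩
  by_contra! hc
  have hdec : ∀ m < n, g (γ (m + 1)) < g (γ 0) := by
    intro m
    induction m with
    | zero => exact fun hm => hc 0 hm
    | succ m ih => exact fun hm => lt_trans (hc (m + 1) hm) (ih (by omega))
  have := hdec (n - 1) (by omega)
  rw [Nat.sub_add_cancel hn, hγ] at this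
  exact lt_irrefl _ this

lemma gradientFlow_mem (h : IsEquilibrium K A B g c) (hc : 0 < c) (hA : MeasurableSet A)
    (hB : MeasurableSet B) (hAB : Disjoint A B) :
    gradientFlow K g c ∈ loopFreeUnitFlows A B K :=
  ⟨⟨h.isUnitFlow_gradientFlow hc hA hB hAB, withDensity_absolutelyContinuous _ _,
    h.isFiniteMeasure_gradientFlow⟩, h.isLoopFree_gradientFlow⟩

/-- The density is proportional to the drop of `g`, the equality case of Cauchy–Schwarz; the path
sum telescopes to `1 / c` on almost every trajectory. -/
lemma flowExpectation_gradientFlow (h : IsEquilibrium K A B g c) (hc : 0 < c)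
    (hA : MeasurableSet A) (hB : MeasurableSet B) (hAB : Disjoint A B) {κ : Kernel Ω Ω}
    [IsMarkovKernel κ] (hκ : gradientFlow K g c = (gradientFlow K g c).fst.compProd κ) :
    flowExpectation A B K (gradientFlow K g c) κ = ENNReal.ofReal c := by
  have := h.isFiniteMeasure_gradientFlow
  have hflow := h.isUnitFlow_gradientFlow hc hA hB hAB
  have hac : gradientFlow K g c ≪ K := withDensity_absolutelyContinuous _ _
  have hQ : ∀ᵐ p ∂(gradientFlow K g c), 0 ≤ (g p.1 - g p.2) / c ∧
      (gradientFlow K g c).rnDeriv K p = ENNReal.ofReal ((g p.1 - g p.2) / c) := by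
    have h1 : ∀ᵐ p ∂(gradientFlow K g c), g p.2 < g p.1 := ae_iff.2 h.gradientFlow_compl_descent
    filter_upwards [h1, hac.ae_le (Measure.rnDeriv_withDensity K h.measurable_gradient)]
      with p hp1 hp2
    refine ⟨div_nonneg (sub_nonneg.2 hp1.le) hc.le, hp2.trans ?_⟩
    rw [max_eq_left (sub_nonneg.2 hp1.le)]
  have hpath : ∀ᵐ Y ∂(flowChainLaw A (gradientFlow K g c) κ),
      (pathResistance B K (gradientFlow K g c) Y)⁻¹ = ENNReal.ofReal c := by
    filter_upwards [hflow.ae_exists_path hA hB hκ hQ] with Y hY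
    obtain ⟨hY0, N, hN, hlt, hstep⟩ := hY
    rw [pathResistance_eq_sum (Set.disjoint_left.1 hAB hY0) hN hlt,
      Finset.sum_congr rfl fun n hn => (hstep n (Finset.mem_range.1 hn)).2,
      ← ENNReal.ofReal_sum_of_nonneg fun n hn => (hstep n (Finset.mem_range.1 hn)).1,
      ← Finset.sum_div, Finset.sum_range_sub' (fun n => g (Y n)), h.eq_one _ hY0,
      h.eq_zero _ hN, sub_zero, one_div, ENNReal.ofReal_inv_of_pos hc, inv_inv]
  rw [flowExpectation, lintegral_congr_ae hpath, lintegral_const, hflow.flowChainLaw_univ hA,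
    mul_one]

end IsEquilibrium

end Flow

end BermanKonsowa

open BermanKonsowa in
theorem theorem2 {Ω : Type*} [TopologicalSpace Ω] [PolishSpace Ω] [MeasurableSpace Ω]
    [BorelSpace Ω]
    (k : Kernel Ω Ω) [IsSFiniteKernel k] (hk : ∀ x, k x Set.univ ≠ ∞)
    (μ : Measure Ω) [SigmaFinite μ]
    (hpos : ∀ᵐ x ∂μ, 0 < k x Set.univ)
    (hrev : BermanKonsowa.IsReversible k μ)
    (hirr : BermanKonsowa.IsIrreducible k μ)
    (hfin : BermanKonsowa.conductance k μ Set.univ ≠ ∞)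
    (A B : Set Ω) (hA : MeasurableSet A) (hB : MeasurableSet B) (hAB : Disjoint A B)
    (ℓ : Measure (Ω × Ω) → Kernel Ω Ω) [∀ Φ, IsMarkovKernel (ℓ Φ)]
    (hℓ : ∀ Φ ∈ BermanKonsowa.unitFlows A B (BermanKonsowa.conductance k μ),
      Φ = Φ.fst.compProd (ℓ Φ)) :
    0 ≤ BermanKonsowa.capacity k μ A B ∧
    ENNReal.ofReal (BermanKonsowa.capacity k μ A B) =
      (⨆ Φ ∈ BermanKonsowa.unitFlows A B (BermanKonsowa.conductance k μ),
        BermanKonsowa.flowExpectation A B (BermanKonsowa.conductance k μ) Φ (ℓ Φ)) ∧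
    ENNReal.ofReal (BermanKonsowa.capacity k μ A B) =
      (⨆ Φ ∈ BermanKonsowa.loopFreeUnitFlows A B (BermanKonsowa.conductance k μ),
        BermanKonsowa.flowExpectation A B (BermanKonsowa.conductance k μ) Φ (ℓ Φ)) ∧
    (0 < μ A → 0 < μ B →
      BermanKonsowa.harmonicFlow k μ A B ∈
        BermanKonsowa.loopFreeUnitFlows A B (BermanKonsowa.conductance k μ) ∧
      BermanKonsowa.flowExpectation A B (BermanKonsowa.conductance k μ)
          (BermanKonsowa.harmonicFlow k μ A B) (ℓ (BermanKonsowa.harmonicFlow k μ A B)) =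
        ENNReal.ofReal (BermanKonsowa.capacity k μ A B)) := by
  have := isFiniteMeasure_conductance hfin
  have heq := isEquilibrium_chainHarmonic hk hpos hrev hfin hA hB hAB
  have hupper : ∀ Φ ∈ unitFlows A B (conductance k μ),
      flowExpectation A B (conductance k μ) Φ (ℓ Φ) ≤ ENNReal.ofReal (capacity k μ A B) :=
    fun Φ hΦ => heq.flowExpectation_le hA hB hAB hΦ (hℓ Φ hΦ)
  have hharm : harmonicFlow k μ A B =
      gradientFlow (conductance k μ) (chainHarmonic k A B) (capacity k μ A B) := by
    refine withDensity_congr_ae ?_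
    filter_upwards [harmonicFunction_fst_snd_ae_eq hk hpos hrev hA hB hAB] with p hp
    rw [hp.1, hp.2]
  have hattain : 0 < μ A → 0 < μ B →
      harmonicFlow k μ A B ∈ loopFreeUnitFlows A B (conductance k μ) ∧
      flowExpectation A B (conductance k μ) (harmonicFlow k μ A B) (ℓ (harmonicFlow k μ A B)) =
        ENNReal.ofReal (capacity k μ A B) := by
    intro hμA hμB
    have hc := capacity_pos hk hpos hrev hirr hfin hA hB hAB hμA hμB
    have hmem := heq.gradientFlow_mem hc hA hB hAB
    rw [hharm]
    exact ⟨hmem, heq.flowExpectation_gradientFlow hc hA hB hAB (hℓ _ hmem.1)⟩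
  -- Both suprema at once: the upper bound holds for every unit flow, and the maximizer is already
  -- loop-free.
  have hsup : ∀ S : Set (Measure (Ω × Ω)), S ⊆ unitFlows A B (conductance k μ) →
      loopFreeUnitFlows A B (conductance k μ) ⊆ S →
      ENNReal.ofReal (capacity k μ A B) =
        ⨆ Φ ∈ S, flowExpectation A B (conductance k μ) Φ (ℓ Φ) := by
    intro S hS hS'
    refine le_antisymm ?_ (iSup₂_le fun Φ hΦ => hupper Φ (hS hΦ))
    rcases eq_zero_or_pos (μ A) with hμA | hμA
    · rw [capacity_eq_zero_of_left A B hμA, ENNReal.ofReal_zero]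
      exact zero_le
    rcases eq_zero_or_pos (μ B) with hμB | hμB
    · rw [capacity_eq_zero_of_right hk hpos hrev hfin hA hB hAB hμB, ENNReal.ofReal_zero]
      exact zero_le
    · obtain ⟨hmem, hval⟩ := hattain hμA hμB
      rw [← hval]
      exact le_iSup₂_of_le _ (hS' hmem) le_rfl
  exact ⟨heq.flux_nonneg, hsup _ subset_rfl fun Φ hΦ => hΦ.1, hsup _ (fun Φ hΦ => hΦ.1) subset_rfl,
    hattain⟩
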